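/- Let $\mu,\nu$ be Borel probability measures on $\mathbb{R}$ with $\mu\ll\nu$ and $\mathrm{d}\mu/\mathrm{d}\nu\in L^2(\nu)$. A ray is a set of the form $(-\infty,a)$ or $(-\infty,a]$ with $a\in\mathbb{R}$, or $\varnothing$, or $\mathbb{R}$. Let $G(\mathcal{R})\subseteq L^2(\nu)$ be the closed convex cone of all $g\in L^2(\nu)$ such that for every $r\in\mathbb{R}$ the set $\{g>r\}$ is, up to a $\nu$-null set, a ray (equivalently, $g$ is $\nu$-almost surely nonincreasing). Let $\rho=\operatorname{proj}_{G(\mathcal{R})}(\mathrm{d}\mu/\mathrm{d}\nu)$ be the metric projection in $L^2(\nu)$, and define the $f$-divergence over rays by $$\mathrm{D}_f^{\mathcal{R}}(\mu\Vert\nu)=\int_{\mathbb{R}} f(\rho)\,\mathrm{d}\nu .$$ Write $T$, $H^2$, $K$, $X$, $L$, $J$ for $\mathrm{D}_f^{\mathcal{R}}(\mu\Vert\nu)$ with, respectively, $f(t)=\tfrac12|t-1|$ (total variation), $(\sqrt t-1)^2$ (squared Hellinger distance, $H\ge 0$), $t\log t$ (Kullback–Leibler), $(t-1)^2$ ($\chi^2$),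 $\frac{(1-t)^2}{2t+2}$ (Le Cam), and $t\log\frac{2t}{t+1}+\log\frac{2}{t+1}$ (Jensen–Shannon), where $0\log 0=0$. When $\nu$ is supported on a finite set, put $\nu_{\min}=\min\{\nu(\{x\}):\nu(\{x\})>0\}$. Then $\rho\ge 0$ $\nu$-almost surely, all six integrals converge absolutely, $T<1$, $H^2<2$, and the following hold. (a) Total variation and Hellinger: $$\tfrac12H^2\le T\le H\sqrt{1-\tfrac{H^2}{4}}\le 1,\qquad T\le\sqrt{-2\log\bigl(1-\tfrac{H^2}{2}\bigr)} .$$ (b) Kullback–Leibler and total variation (Pinsker, strong Pinsker, reverse Pinsker): $$T^2\le\tfrac12K,\qquad \log\frac{1+T}{1-T}-\frac{2T}{1+T}\le K,$$ and, if $\nu$ is finitely supported, $$K\le\log\Bigl(1+\frac{2}{\nu_{\min}}T^2\Bigr)\le\frac{2}{\nu_{\min}}T^2 .$$ (c) Total variation and $\chi^2$: $$T^2\le\tfrac14X,\qquad T\le\max\Bigl\{\tfrac12,\frac{X}{1+X}\Bigr\},\qquad 4T^2\le\varphi(T)\le X,$$ where $\varphi(t)=4t^2$ for $t\le\tfrac12$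 and $\varphi(t)=t/(1-t)$ for $t\ge\tfrac12$. (d) Kullback–Leibler and Hellinger: $$H^2\le 2\log\frac{2}{2-H^2}\le K,$$ and, if $\nu$ is finitely supported and is not a point mass, $$K\le\frac{\log(1/\nu_{\min}-1)}{1-2\nu_{\min}}\Bigl(1-\bigl(1-\tfrac{H^2}{2}\bigr)^2\Bigr),$$ where for $\nu_{\min}=\tfrac12$ the fraction is read as its limit $2$. (e) Kullback–Leibler and $\chi^2$: $\;K\le\log(1+X)\le X$. (f) Le Cam and Hellinger: $\;\tfrac12H^2\le L\le H^2$. (g) Le Cam and Jensen–Shannon: $\;L\le J\le 2\log 2\cdot L$. -/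

import Mathlib

open MeasureTheory Filter Topology Set

noncomputable section

namespace RayDivergence

/-- The class of (left) rays `(-∞, a)`, `(-∞, a]`, together with `∅` and `ℝ`. -/
def rays : Set (Set ℝ) :=
  {A | A = ∅ ∨ A = univ ∨ ∃ a : ℝ, A = Iio a ∨ A = Iic a}

/-- The cone of those `g ∈ L²(ν)` all of whose strict superlevel sets `{g > r}` are rays.
Elements of `L²(ν)` are classes of functions modulo equality `ν`-almost everywhere, so the
condition is imposed modulo `ν`-null sets. -/
def rayCone (ν : Measure ℝ) : Set (Lp ℝ 2 ν) :=
  {g | ∀ r : ℝ, ∃ A ∈ rays, ({x : ℝ | r < g x} : Set ℝ) =ᵐ[ν] A}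

theorem mem_rays_of_isLowerSet {A : Set ℝ} (hA : IsLowerSet A) : A ∈ rays := by
  by_cases h0 : A = ∅
  · exact Or.inl h0
  by_cases hb : BddAbove A
  · refine Or.inr (Or.inr ⟨sSup A, ?_⟩)
    have hne : A.Nonempty := nonempty_iff_ne_empty.mpr h0
    by_cases hs : sSup A ∈ A
    · right
      ext x
      exact ⟨fun hx => le_csSup hb hx, fun hx => hA hx hs⟩
    · left
      ext x
      constructor
      · intro hx
        refine lt_of_le_of_ne (le_csSup hb hx) ?_
        rintro rfl
        exact hs hx
      · intro hx
        obtain ⟨y, hy, hxy⟩ := exists_lt_of_lt_csSup hne hx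
        exact hA hxy.le hy
  · refine Or.inr (Or.inl ?_)
    ext x
    simp only [mem_univ, iff_true]
    obtain ⟨y, hy, hxy⟩ := not_bddAbove_iff.mp hb x
    exact hA hxy.le hy

theorem isLowerSet_of_mem_rays {A : Set ℝ} (hA : A ∈ rays) : IsLowerSet A := by
  rcases hA with rfl | rfl | ⟨a, rfl | rfl⟩
  · exact isLowerSet_empty
  · exact isLowerSet_univ
  · exact isLowerSet_Iio a
  · exact isLowerSet_Iic a

/-- The cone consists exactly of the (almost everywhere) nonincreasing elements of `L²(ν)`. -/
theorem mem_rayCone_iff {ν : Measure ℝ} {g : Lp ℝ 2 ν} :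
    g ∈ rayCone ν ↔ ∃ S : Set ℝ, (∀ᵐ x ∂ν, x ∈ S) ∧ AntitoneOn g S := by
  constructor
  · intro hg
    choose A hA hgA using hg
    refine ⟨{x | ∀ q : ℚ, ((q : ℝ) < g x ↔ x ∈ A q)}, ?_, ?_⟩
    · have h : ∀ q : ℚ, ∀ᵐ x ∂ν, ((q : ℝ) < g x ↔ x ∈ A q) := fun q => by
        filter_upwards [hgA q] with x hx
        exact iff_of_eq hx
      exact ae_all_iff.mpr h
    · intro x hx y hy hxy
      by_contra! hlt
      obtain ⟨q, hq1, hq2⟩ := exists_rat_btwn hlt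
      have h1 : y ∈ A q := (hy q).mp hq2
      have h2 : x ∈ A q := isLowerSet_of_mem_rays (hA q) hxy h1
      exact absurd ((hx q).mpr h2) (not_lt.mpr hq1.le)
  · rintro ⟨S, hS, hg⟩ r
    refine ⟨{x | ∃ y ∈ S, x ≤ y ∧ r < g y}, mem_rays_of_isLowerSet ?_, ?_⟩
    · rintro a b hba ⟨y, hy, hay, hr⟩
      exact ⟨y, hy, hba.trans hay, hr⟩
    · filter_upwards [hS] with x hx
      refine propext ⟨fun h => ⟨x, hx, le_rfl, h⟩, ?_⟩
      rintro ⟨y, hy, hxy, hr⟩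
      exact lt_of_lt_of_le hr (hg hx hy hxy)

theorem zero_mem_rayCone (ν : Measure ℝ) : (0 : Lp ℝ 2 ν) ∈ rayCone ν := by
  rw [mem_rayCone_iff]
  refine ⟨{x | (0 : Lp ℝ 2 ν) x = 0}, Lp.coeFn_zero ℝ 2 ν, ?_⟩
  intro x hx y hy _
  change (0 : Lp ℝ 2 ν) x = 0 at hx
  change (0 : Lp ℝ 2 ν) y = 0 at hy
  rw [hx, hy]

theorem convex_rayCone (ν : Measure ℝ) : Convex ℝ (rayCone ν) := by
  intro g hg h hh a b ha hb _
  rw [mem_rayCone_iff] at hg hh ⊢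
  obtain ⟨S, hS, hgS⟩ := hg
  obtain ⟨T, hT, hhT⟩ := hh
  refine ⟨{x | x ∈ S ∧ x ∈ T ∧ (a • g + b • h : Lp ℝ 2 ν) x = a * g x + b * h x}, ?_, ?_⟩
  · filter_upwards [hS, hT, Lp.coeFn_add (a • g) (b • h), Lp.coeFn_smul a g,
      Lp.coeFn_smul b h] with x h1 h2 h3 h4 h5
    refine ⟨h1, h2, ?_⟩
    rw [h3, Pi.add_apply, h4, h5]
    rfl
  · rintro x ⟨h1, h2, h3⟩ y ⟨k1, k2, k3⟩ hxy
    rw [h3, k3]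
    have e1 := mul_le_mul_of_nonneg_left (hgS h1 k1 hxy) ha
    have e2 := mul_le_mul_of_nonneg_left (hhT h2 k2 hxy) hb
    linarith

theorem isClosed_rayCone (ν : Measure ℝ) : IsClosed (rayCone ν) := by
  refine IsSeqClosed.isClosed ?_
  intro u g hu hlim
  have hu' : ∀ n, ∃ S : Set ℝ, (∀ᵐ x ∂ν, x ∈ S) ∧ AntitoneOn (u n) S :=
    fun n => mem_rayCone_iff.mp (hu n)
  choose S hS hanti using hu'
  obtain ⟨ns, -, hns⟩ := (tendstoInMeasure_of_tendsto_Lp hlim).exists_seq_tendsto_ae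
  rw [mem_rayCone_iff]
  refine ⟨{x | (∀ n, x ∈ S n) ∧ Tendsto (fun i => u (ns i) x) atTop (𝓝 (g x))}, ?_, ?_⟩
  · filter_upwards [ae_all_iff.mpr hS, hns] with x h1 h2
    exact ⟨h1, h2⟩
  · rintro x ⟨h1, h2⟩ y ⟨k1, k2⟩ hxy
    exact le_of_tendsto_of_tendsto' k2 h2 fun i => hanti (ns i) (h1 _) (k1 _) hxy

/-- Existence and uniqueness of the nearest point of the cone. -/
theorem existsUnique_nearest (ν : Measure ℝ) (g : Lp ℝ 2 ν) :
    ∃! p : Lp ℝ 2 ν, p ∈ rayCone ν ∧ ∀ h ∈ rayCone ν, ‖g - p‖ ≤ ‖g - h‖ := by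
  have hbdd : BddBelow (range fun w : rayCone ν => ‖g - w‖) :=
    ⟨0, by rintro _ ⟨w, rfl⟩; exact norm_nonneg _⟩
  have hne : Nonempty (rayCone ν) := ⟨⟨0, zero_mem_rayCone ν⟩⟩
  have key : ∀ p ∈ rayCone ν, (∀ h ∈ rayCone ν, ‖g - p‖ ≤ ‖g - h‖) →
      ‖g - p‖ = ⨅ w : rayCone ν, ‖g - w‖ := fun p hp hmin =>
    le_antisymm (le_ciInf fun w => hmin w w.2) (ciInf_le hbdd ⟨p, hp⟩)
  obtain ⟨p, hp, hpe⟩ := exists_norm_eq_iInf_of_complete_convex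
    ⟨0, zero_mem_rayCone ν⟩ (isClosed_rayCone ν).isComplete (convex_rayCone ν) g
  refine ⟨p, ⟨hp, fun h hh => hpe ▸ ciInf_le hbdd ⟨h, hh⟩⟩, ?_⟩
  rintro q ⟨hq, hqmin⟩
  have h1 := (norm_eq_iInf_iff_real_inner_le_zero (convex_rayCone ν) hp).mp hpe q hq
  have h2 := (norm_eq_iInf_iff_real_inner_le_zero (convex_rayCone ν) hq).mp
    (key q hq hqmin) p hp
  have h3 : inner ℝ (q - p) (q - p) ≤ 0 := by
    have e : inner ℝ (q - p) (q - p) = inner ℝ (g - p) (q - p) + inner ℝ (g - q) (p - q) := by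
      rw [← neg_sub q p, inner_neg_right, ← sub_eq_add_neg, ← inner_sub_left]
      congr 1
      abel
    rw [e]
    linarith
  rw [real_inner_self_eq_norm_sq] at h3
  have h4 : ‖q - p‖ = 0 := by nlinarith [norm_nonneg (q - p)]
  exact sub_eq_zero.mp (norm_eq_zero.mp h4)

/-- The metric projection of `L²(ν)` onto the closed convex cone `rayCone ν`. -/
def rayProj (ν : Measure ℝ) (g : Lp ℝ 2 ν) : Lp ℝ 2 ν :=
  (existsUnique_nearest ν g).choose

theorem rayProj_spec (ν : Measure ℝ) (g : Lp ℝ 2 ν) :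
    rayProj ν g ∈ rayCone ν ∧ ∀ h ∈ rayCone ν, ‖g - rayProj ν g‖ ≤ ‖g - h‖ :=
  (existsUnique_nearest ν g).choose_spec.1

/-- The Radon--Nikodym derivative `dμ/dν` as a real-valued function. -/
def density (μ ν : Measure ℝ) : ℝ → ℝ := fun x => (μ.rnDeriv ν x).toReal

/-- The projection onto `rayCone ν` of a square-integrable density `dμ/dν`. -/
def rayDensity {μ ν : Measure ℝ} (h : MemLp (density μ ν) 2 ν) : Lp ℝ 2 ν :=
  rayProj ν h.toLp

/-- The `f`-divergence over rays, `∫ f (proj (dμ/dν)) dν`. -/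
def rayDiv (f : ℝ → ℝ) {μ ν : Measure ℝ} (h : MemLp (density μ ν) 2 ν) : ℝ :=
  ∫ x, f (rayDensity h x) ∂ν

/-- Total variation: `|t - 1| / 2`. -/
def tvFun (t : ℝ) : ℝ := |t - 1| / 2

/-- Squared Hellinger: `(√t - 1)²`. -/
def hlFun (t : ℝ) : ℝ := (√t - 1) ^ 2

/-- Kullback--Leibler: `t log t`; since `Real.log 0 = 0`, the value at `0` is the limit `0`. -/
def klFun (t : ℝ) : ℝ := t * Real.log t

/-- Pearson `χ²`: `(t - 1)²`. -/
def chiSqFun (t : ℝ) : ℝ := (t - 1) ^ 2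

/-- Le Cam: `(1 - t)² / (2t + 2)`. -/
def lcFun (t : ℝ) : ℝ := (1 - t) ^ 2 / (2 * t + 2)

/-- Jensen--Shannon: `t log (2t / (t+1)) + log (2 / (t+1))`; at `0` this is the limit `log 2`. -/
def jsFun (t : ℝ) : ℝ := t * Real.log (2 * t / (t + 1)) + Real.log (2 / (t + 1))

section
variable {μ ν : Measure ℝ}

/-- Total variation over rays. -/
def rayTV (h : MemLp (density μ ν) 2 ν) : ℝ := rayDiv tvFun h

/-- Hellinger distance over rays: its square is the divergence generated by `(√t - 1)²`. -/
def rayHl (h : MemLp (density μ ν) 2 ν) : ℝ := √(rayDiv hlFun h)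

/-- Kullback--Leibler divergence over rays. -/
def rayKL (h : MemLp (density μ ν) 2 ν) : ℝ := rayDiv klFun h

/-- `χ²`-divergence over rays. -/
def rayChiSq (h : MemLp (density μ ν) 2 ν) : ℝ := rayDiv chiSqFun h

/-- Le Cam divergence over rays. -/
def rayLC (h : MemLp (density μ ν) 2 ν) : ℝ := rayDiv lcFun h

/-- Jensen--Shannon divergence over rays. -/
def rayJS (h : MemLp (density μ ν) 2 ν) : ℝ := rayDiv jsFun h

end

/-- `ν` is concentrated on a finite set. -/
def FinitelySupported (ν : Measure ℝ) : Prop := ∃ S : Finset ℝ, ν (S : Set ℝ)ᶜ = 0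

/-- The least mass `min_x ν {x}` over the points `x` that carry mass (a minimum over a
nonempty finite set when `ν` is a finitely supported probability measure). -/
def minAtom (ν : Measure ℝ) : ℝ := sInf ((fun x : ℝ => ν.real {x}) '' {x | ν {x} ≠ 0})

/-- The piecewise function in the sharp bound between total variation and `χ²`. -/
def tvChiFun (t : ℝ) : ℝ := if t ≤ 1 / 2 then 4 * t ^ 2 else t / (1 - t)

/-- The factor `log (1/p - 1) / (1 - 2p)`, extended to `p = 1/2` by its limit `2`. -/
def klHlFactor (p : ℝ) : ℝ := if p = 1 / 2 then 2 else Real.log (1 / p - 1) / (1 - 2 * p)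

end RayDivergence

end

open RayDivergence

namespace RayDivergence

/-! ### Monotonicity from a sign of the derivative -/

/-! The order structure of the rays matters only once: the projection `ρ` is itself a probability
density. The variational inequality tested with `ρ⁺` gives `ρ ≥ 0`, and tested with `ρ ± 1` it gives
`∫ ρ dν = 1`. Every inequality then holds for an arbitrary square-integrable probability density `r`
(`IsSqDensity`). All generators grow at most quadratically, so integrability is automatic.

Two devices give the bounds without assumptions on the support. One is Cauchy–Schwarz for `|r - 1|`
(`sq_integral_abs_le`). The other integrates a pointwise bound `a + b t + c f(t) ≤ g(t)`
(`affine_add_integral_le`), where the mean of `r` is known and the constants may depend on the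
divergences being compared. Jensen's inequality enters in this form, through a tangent line at the
mean.

On a finite support, a centred function at an atom is controlled by its `L¹` or `L²` norm. The `L¹`
bound gives reverse Pinsker through `χ²`. The `L²` bound caps `Y = √r` at a level `B`. A quadratic
in `Y` that dominates `Y² log Y` up to `B` reduces the entropy bound to a two-point law with the
same first two moments (`kl_le_of_sqrt_le`). There the claim is a one-variable inequality, settled
by the monotonicity of `sinh z / z` (`klHlGap_nonneg`). -/

theorem le_of_hasDerivAt_nonneg {F F' : ℝ → ℝ} {a b : ℝ} (hab : a ≤ b)
    (hc : ContinuousOn F (Icc a b)) (hd : ∀ t ∈ Ioo a b, HasDerivAt F (F' t) t)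
    (hs : ∀ t ∈ Ioo a b, 0 ≤ F' t) : F a ≤ F b := by
  refine monotoneOn_of_deriv_nonneg (convex_Icc a b) hc ?_ ?_ (left_mem_Icc.mpr hab)
    (right_mem_Icc.mpr hab) hab
  · rw [interior_Icc]
    exact fun t ht => (hd t ht).differentiableAt.differentiableWithinAt
  · rw [interior_Icc]
    exact fun t ht => (hd t ht).deriv ▸ hs t ht

theorem ge_of_hasDerivAt_nonpos {F F' : ℝ → ℝ} {a b : ℝ} (hab : a ≤ b)
    (hc : ContinuousOn F (Icc a b)) (hd : ∀ t ∈ Ioo a b, HasDerivAt F (F' t) t)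
    (hs : ∀ t ∈ Ioo a b, F' t ≤ 0) : F b ≤ F a := by
  have := le_of_hasDerivAt_nonneg (F := fun t => -F t) (F' := fun t => -F' t) hab hc.neg
    (fun t ht => (hd t ht).neg) (fun t ht => by linarith [hs t ht])
  linarith

/-- A function on `(0, ∞)` whose derivative changes sign from `-` to `+` at `a` is minimal there. -/
theorem le_of_hasDerivAt_valley {F F' : ℝ → ℝ} {a : ℝ} (ha : 0 < a)
    (hd : ∀ t, 0 < t → HasDerivAt F (F' t) t) (hl : ∀ t, 0 < t → t < a → F' t ≤ 0)
    (hr : ∀ t, a < t → 0 ≤ F' t) {t : ℝ} (ht : 0 < t) : F a ≤ F t := by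
  rcases le_total a t with h | h
  · exact le_of_hasDerivAt_nonneg h
      (fun x hx => (hd x (ha.trans_le hx.1)).continuousAt.continuousWithinAt)
      (fun x hx => hd x (ha.trans hx.1)) (fun x hx => hr x hx.1)
  · exact ge_of_hasDerivAt_nonpos h
      (fun x hx => (hd x (ht.trans_le hx.1)).continuousAt.continuousWithinAt)
      (fun x hx => hd x (ht.trans hx.1)) (fun x hx => hl x (ht.trans hx.1) hx.2)

/-! ### Elementary inequalities for the logarithm and `sinh` -/

/-- Since `sinh (log u) = (u - u⁻¹) / 2`, this is `z ≤ sinh z` at `z = log u`. -/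
theorem two_mul_log_le_sub_inv {u : ℝ} (hu : 1 ≤ u) : 2 * Real.log u ≤ u - u⁻¹ := by
  have h := Real.self_le_sinh_iff.mpr (Real.log_nonneg hu)
  rw [Real.sinh_log (by linarith)] at h
  linarith

/-- Convexity of `sinh` on `[0, ∞)` and `sinh 0 = 0` make `sinh z / z` nondecreasing; this is the
denominator-free form. -/
theorem mul_sinh_le {z w : ℝ} (hz : 0 ≤ z) (hzw : z ≤ w) :
    w * Real.sinh z ≤ z * Real.sinh w := by
  rcases hz.eq_or_lt with rfl | hz0
  · simp
  have hw : 0 < w := hz0.trans_le hzw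
  have hconv : ConvexOn ℝ (Ici 0) Real.sinh := by
    refine convexOn_of_deriv2_nonneg (convex_Ici 0) Real.continuous_sinh.continuousOn
      Real.differentiable_sinh.differentiableOn ?_ ?_
    · rw [Real.deriv_sinh]
      exact Real.differentiable_cosh.differentiableOn
    · intro x hx
      rw [interior_Ici] at hx
      simp only [Function.iterate_succ, Function.iterate_zero, Function.comp_apply,
        Real.deriv_sinh, Real.deriv_cosh, id]
      exact Real.sinh_nonneg_iff.mpr (le_of_lt hx)
  have hzw1 : z / w ≤ 1 := (div_le_one hw).mpr hzw
  have h := hconv.2 (mem_Ici.mpr hw.le) (mem_Ici.mpr le_rfl) (by positivity : 0 ≤ z / w)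
    (sub_nonneg.mpr hzw1) (by ring)
  simp only [smul_eq_mul, mul_zero, add_zero, Real.sinh_zero, div_mul_cancel₀ z hw.ne'] at h
  rw [div_mul_eq_mul_div, le_div_iff₀ hw] at h
  linarith

/-- The tangent line at `c` lies below the convex function `t log t`. -/
theorem mul_log_add_sub_le {t c : ℝ} (ht : 0 ≤ t) (hc : 0 < c) :
    t * Real.log c + t - c ≤ t * Real.log t := by
  rcases ht.eq_or_lt with rfl | ht
  · simp [hc.le]
  have h := Real.one_sub_inv_le_log_of_pos (div_pos ht hc)
  rw [Real.log_div ht.ne' hc.ne', inv_div] at h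
  have h2 := mul_le_mul_of_nonneg_left h ht.le
  have : t * (1 - c / t) = t - c := by field_simp
  linarith

theorem log_le_div_add_log {t c : ℝ} (ht : 0 < t) (hc : 0 < c) :
    Real.log t ≤ t / c - 1 + Real.log c := by
  have h := Real.log_le_sub_one_of_pos (div_pos ht hc)
  rw [Real.log_div ht.ne' hc.ne'] at h
  linarith

/-! ### Pointwise comparison of the generators -/

/-- The weight `(2t + 4) / 3` integrates to `2` against a density of mean one, which produces the
sharp Pinsker constant after Cauchy–Schwarz. -/
theorem pinsker_pointwise {t : ℝ} (ht : 0 ≤ t) :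
    3 * (t - 1) ^ 2 ≤ (2 * t + 4) * (t * Real.log t - t + 1) := by
  rcases ht.eq_or_lt with rfl | ht
  · norm_num
  -- Dividing by the factor of `log t` leaves a function with rational derivative, whose sign is
  -- that of `(t - 1)³`.
  have key : (0 : ℝ) ≤ Real.log t - (5 * t ^ 2 - 4 * t - 1) / (2 * t ^ 2 + 4 * t) := by
    have h := le_of_hasDerivAt_valley
      (F := fun t => Real.log t - (5 * t ^ 2 - 4 * t - 1) / (2 * t ^ 2 + 4 * t))
      (F' := fun t => 4 * (t - 1) ^ 3 / (2 * t ^ 2 + 4 * t) ^ 2) one_pos ?_ ?_ ?_ ht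
    · norm_num at h ⊢
      linarith
    · intro x hx
      have hD : 2 * x ^ 2 + 4 * x ≠ 0 := by positivity
      have h1 : HasDerivAt (fun t : ℝ => 5 * t ^ 2 - 4 * t - 1) (10 * x - 4) x := by
        convert! (((hasDerivAt_pow 2 x).const_mul 5).sub
          ((hasDerivAt_id x).const_mul 4)).sub_const 1 using 1
        norm_num; ring
      have h2 : HasDerivAt (fun t : ℝ => 2 * t ^ 2 + 4 * t) (4 * x + 4) x := by
        convert! ((hasDerivAt_pow 2 x).const_mul 2).add ((hasDerivAt_id x).const_mul 4) using 1
        norm_num; ring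
      convert! (Real.hasDerivAt_log hx.ne').sub (h1.div h2 hD) using 1
      field_simp
      ring
    · intro x hx hx1
      apply div_nonpos_of_nonpos_of_nonneg _ (by positivity)
      have : (x - 1) ^ 3 = -(1 - x) ^ 3 := by ring
      have h3 : 0 ≤ (1 - x) ^ 3 := pow_nonneg (by linarith) 3
      linarith
    · intro x hx1
      have h3 : 0 ≤ (x - 1) ^ 3 := pow_nonneg (by linarith) 3
      positivity
  have h2 := mul_nonneg (by positivity : 0 ≤ 2 * t ^ 2 + 4 * t) key
  rw [mul_sub, mul_div_cancel₀ _ (by positivity)] at h2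
  nlinarith

/-- The minorant is piecewise affine with a kink at `1`. Its right branch is the tangent line at
`s⁻¹`. Its left branch falls below the tangent line at `s` by `t (s⁻¹ - s + 2 log s) ≥ 0`. -/
theorem strong_pinsker_pointwise {s t : ℝ} (hs : 0 < s) (hs1 : s ≤ 1) (ht : 0 ≤ t) :
    t * (1 - Real.log s) - s⁻¹ + (s⁻¹ - s) * ((|t - 1| + 1 - t) / 2) ≤ t * Real.log t := by
  rcases le_total 1 t with h1 | h1
  · rw [abs_of_nonneg (by linarith)]
    have h := mul_log_add_sub_le ht (inv_pos.mpr hs)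
    rw [Real.log_inv] at h
    linarith
  · rw [abs_of_nonpos (by linarith)]
    have h := mul_log_add_sub_le ht hs
    have h2 := two_mul_log_le_sub_inv ((one_le_inv₀ hs).mpr hs1)
    rw [Real.log_inv, inv_inv] at h2
    nlinarith

/-- The right branch is tangent to `(t - 1)²` at `1 + k`. On the left, with `u = 1 - t`, the
difference is `(u - 1)(u - k²)`, nonnegative because `u ≤ 1 ≤ k²`. Contact occurs at `0` and `1 +
k`. -/
theorem chiSq_tv_pointwise {k t : ℝ} (hk : 1 ≤ k) (ht : 0 ≤ t) :
    (1 + k ^ 2) * ((|t - 1| + 1 - t) / 2) + 2 * k * ((|t - 1| + t - 1) / 2) - k ^ 2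
      ≤ (t - 1) ^ 2 := by
  rcases le_total 1 t with h1 | h1
  · rw [abs_of_nonneg (by linarith)]
    nlinarith [sq_nonneg (t - 1 - k)]
  · rw [abs_of_nonpos (by linarith)]
    nlinarith [mul_nonneg (by nlinarith : 0 ≤ k ^ 2 - 1) ht, sq_nonneg t]


theorem hlFun_le_abs {t : ℝ} (ht : 0 ≤ t) : hlFun t ≤ |t - 1| := by
  unfold hlFun
  obtain ⟨y, hy, rfl⟩ : ∃ y, 0 ≤ y ∧ t = y ^ 2 := ⟨√t, Real.sqrt_nonneg t, (Real.sq_sqrt ht).symm⟩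
  rw [Real.sqrt_sq hy]
  rcases le_total 1 y with h | h
  · exact le_trans (by nlinarith) (le_abs_self _)
  · exact le_trans (by nlinarith) (neg_le_abs _)

/-- With `y = √t`, the Le Cam generator is the Hellinger one times `(y + 1)² / (2 (y² + 1))`, a
factor between `1/2` and `1`. -/
theorem hlFun_le_lcFun {t : ℝ} (ht : 0 ≤ t) : 1 / 2 * hlFun t ≤ lcFun t := by
  unfold hlFun lcFun
  rw [le_div_iff₀ (by linarith)]
  obtain ⟨y, hy, rfl⟩ : ∃ y, 0 ≤ y ∧ t = y ^ 2 := ⟨√t, Real.sqrt_nonneg t, (Real.sq_sqrt ht).symm⟩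
  rw [Real.sqrt_sq hy]
  have : (1 - y ^ 2) ^ 2 = (y - 1) ^ 2 * (y + 1) ^ 2 := by ring
  rw [this]
  nlinarith [mul_nonneg (sq_nonneg (y - 1)) hy]

theorem lcFun_le_hlFun {t : ℝ} (ht : 0 ≤ t) : lcFun t ≤ hlFun t := by
  unfold hlFun lcFun
  rw [div_le_iff₀ (by linarith)]
  obtain ⟨y, hy, rfl⟩ : ∃ y, 0 ≤ y ∧ t = y ^ 2 := ⟨√t, Real.sqrt_nonneg t, (Real.sq_sqrt ht).symm⟩
  rw [Real.sqrt_sq hy]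
  nlinarith [mul_nonneg (sq_nonneg (y - 1)) (sq_nonneg (y - 1))]

theorem one_add_mul_log_hasDerivAt {x : ℝ} (h0 : -1 < x) (h1 : x < 1) :
    HasDerivAt (fun x => (1 + x) * Real.log (1 + x) + (1 - x) * Real.log (1 - x))
      (Real.log (1 + x) - Real.log (1 - x)) x := by
  have hp : HasDerivAt (fun x : ℝ => 1 + x) 1 x := (hasDerivAt_id x).const_add 1
  have hm : HasDerivAt (fun x : ℝ => 1 - x) (-1) x := (hasDerivAt_id x).const_sub 1
  have h2 : 1 + x ≠ 0 := by linarith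
  have h3 : 1 - x ≠ 0 := by linarith
  convert! (hp.mul (hp.log h2)).add (hm.mul (hm.log h3)) using 1
  field_simp
  ring

theorem one_add_mul_log_continuous :
    Continuous (fun x : ℝ => (1 + x) * Real.log (1 + x) + (1 - x) * Real.log (1 - x)) :=
  (Real.continuous_mul_log.comp (continuous_const.add continuous_id)).add
    (Real.continuous_mul_log.comp (continuous_const.sub continuous_id))

theorem log_one_add_sub_bounds {x : ℝ} (h0 : 0 ≤ x) (h1 : x < 1) :
    2 * x ≤ Real.log (1 + x) - Real.log (1 - x) ∧
      Real.log (1 + x) - Real.log (1 - x) ≤ 2 * x / (1 - x ^ 2) := by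
  have hd : ∀ y, y < x → 0 < y → HasDerivAt (fun y => Real.log (1 + y) - Real.log (1 - y) - 2 * y)
      (2 * y ^ 2 / (1 - y ^ 2)) y := by
    intro y hy hy0
    have hp : HasDerivAt (fun x : ℝ => 1 + x) 1 y := (hasDerivAt_id y).const_add 1
    have hm : HasDerivAt (fun x : ℝ => 1 - x) (-1) y := (hasDerivAt_id y).const_sub 1
    have h2 : 1 + y ≠ 0 := by linarith
    have h3 : 1 - y ≠ 0 := by linarith
    have h4 : 1 - y ^ 2 ≠ 0 := by nlinarith
    convert! ((hp.log h2).sub (hm.log h3)).sub ((hasDerivAt_id y).const_mul 2) using 1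
    field_simp
    ring
  constructor
  · have h := le_of_hasDerivAt_nonneg h0 (F' := fun y => 2 * y ^ 2 / (1 - y ^ 2))
      (F := fun y => Real.log (1 + y) - Real.log (1 - y) - 2 * y) ?_ (fun y hy => hd y hy.2 hy.1) ?_
    · norm_num at h
      linarith
    · refine ContinuousOn.sub (ContinuousOn.sub (ContinuousOn.log (by fun_prop) ?_)
        (ContinuousOn.log (by fun_prop) ?_)) (by fun_prop)
      · intro y hy; have := hy.1; linarith
      · intro y hy; have := hy.2; linarith
    · intro y hy
      have := hy.1; have := hy.2
      have : 0 ≤ 1 - y ^ 2 := by nlinarith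
      positivity
  · have hm : 0 < 1 - x := by linarith
    have hp : 0 < 1 + x := by linarith
    have h := two_mul_log_le_sub_inv (u := (1 + x) / (1 - x)) (by rw [le_div_iff₀ hm]; linarith)
    rw [Real.log_div hp.ne' hm.ne', inv_div] at h
    have e : 2 * (2 * x / (1 - x ^ 2)) = (1 + x) / (1 - x) - (1 - x) / (1 + x) := by
      have : 1 - x ^ 2 = (1 - x) * (1 + x) := by ring
      rw [this]
      field_simp
      ring
    linarith

theorem one_add_mul_log_bounds {x : ℝ} (h0 : 0 ≤ x) (h1 : x ≤ 1) :
    x ^ 2 ≤ (1 + x) * Real.log (1 + x) + (1 - x) * Real.log (1 - x) ∧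
      (1 + x) * Real.log (1 + x) + (1 - x) * Real.log (1 - x) ≤ 2 * Real.log 2 * x ^ 2 := by
  constructor
  · have h := le_of_hasDerivAt_nonneg h0
      (F := fun x => (1 + x) * Real.log (1 + x) + (1 - x) * Real.log (1 - x) - x ^ 2)
      (F' := fun x => Real.log (1 + x) - Real.log (1 - x) - 2 * x)
      (one_add_mul_log_continuous.sub (continuous_pow 2)).continuousOn ?_ ?_
    · norm_num at h
      linarith
    · intro y hy
      have := hy.1; have := hy.2
      convert! (one_add_mul_log_hasDerivAt (x := y) (by linarith) (by linarith)).sub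
        (hasDerivAt_pow 2 y) using 1
      norm_num
    · intro y hy
      linarith [(log_one_add_sub_bounds hy.1.le (hy.2.trans_le h1)).1]
  · rcases h0.eq_or_lt with rfl | h0
    · simp
    -- The quotient by `x²` increases on `(0, 1]`, and its value at `1` is `2 log 2` because `0 log
    -- 0 = 0`.
    have h := le_of_hasDerivAt_nonneg h1
      (F := fun x => ((1 + x) * Real.log (1 + x) + (1 - x) * Real.log (1 - x)) / x ^ 2)
      (F' := fun x => ((Real.log (1 + x) - Real.log (1 - x)) * x ^ 2 -
        ((1 + x) * Real.log (1 + x) + (1 - x) * Real.log (1 - x)) * (2 * x)) / (x ^ 2) ^ 2)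
      (one_add_mul_log_continuous.continuousOn.div (by fun_prop)
        (fun y hy => by have := h0.trans_le hy.1; positivity)) ?_ ?_
    · have h' : 0 < x ^ 2 := by positivity
      norm_num at h
      rw [div_le_iff₀ h'] at h
      exact h
    · intro y hy
      have hy0 := h0.trans hy.1
      have := hy.2
      convert! (one_add_mul_log_hasDerivAt (x := y) (by linarith) (by linarith)).div
        (hasDerivAt_pow 2 y) (by positivity) using 1
      norm_num
    · intro y hy
      have hy0 := h0.trans hy.1
      apply div_nonneg _ (by positivity)
      have hs : 0 ≤ -(2 + y) * Real.log (1 + y) - (2 - y) * Real.log (1 - y) := by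
        have h := le_of_hasDerivAt_nonneg hy0.le
          (F := fun y => -(2 + y) * Real.log (1 + y) - (2 - y) * Real.log (1 - y))
          (F' := fun y => 2 * y / (1 - y ^ 2) - (Real.log (1 + y) - Real.log (1 - y))) ?_ ?_ ?_
        · norm_num at h ⊢
          linarith
        · refine ContinuousOn.sub (ContinuousOn.mul (by fun_prop) (ContinuousOn.log (by fun_prop) ?_))
            (ContinuousOn.mul (by fun_prop) (ContinuousOn.log (by fun_prop) ?_))
          · intro w hw; have := hw.1; linarith
          · intro w hw; have := hw.2; have := hy.2; linarith
        · intro w hw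
          have hw0 := hw.1
          have hw1 := hw.2.trans hy.2
          have hp : HasDerivAt (fun x : ℝ => 1 + x) 1 w := (hasDerivAt_id w).const_add 1
          have hm : HasDerivAt (fun x : ℝ => 1 - x) (-1) w := (hasDerivAt_id w).const_sub 1
          have hp2 : HasDerivAt (fun x : ℝ => -(2 + x)) (-1) w :=
            ((hasDerivAt_id w).const_add 2).neg
          have hm2 : HasDerivAt (fun x : ℝ => 2 - x) (-1) w := (hasDerivAt_id w).const_sub 2
          have h2 : 1 + w ≠ 0 := by linarith
          have h3 : 1 - w ≠ 0 := by linarith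
          have h4 : 1 - w ^ 2 ≠ 0 := by nlinarith
          convert! (hp2.mul (hp.log h2)).sub (hm2.mul (hm.log h3)) using 1
          have : 1 - w ^ 2 = (1 - w) * (1 + w) := by ring
          rw [this]
          field_simp
          ring
        · intro w hw
          linarith [(log_one_add_sub_bounds hw.1.le (hw.2.trans hy.2)).2]
      have : (Real.log (1 + y) - Real.log (1 - y)) * y ^ 2 -
          ((1 + y) * Real.log (1 + y) + (1 - y) * Real.log (1 - y)) * (2 * y)
          = y * (-(2 + y) * Real.log (1 + y) - (2 - y) * Real.log (1 - y)) := by ring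
      rw [this]
      positivity

/-- In the variable `x = (t - 1) / (t + 1)` both generators are `(t + 1) / 2` times an even function
of `x`, so `one_add_mul_log_bounds` on `[0, 1]` suffices. -/
theorem lcFun_le_jsFun_le {t : ℝ} (ht : 0 ≤ t) :
    lcFun t ≤ jsFun t ∧ jsFun t ≤ 2 * Real.log 2 * lcFun t := by
  have htp : 0 < t + 1 := by linarith
  set x : ℝ := (t - 1) / (t + 1) with hx
  have ep : 1 + x = 2 * t / (t + 1) := by rw [hx]; field_simp; ring
  have em : 1 - x = 2 / (t + 1) := by rw [hx]; field_simp; ring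
  have hL : lcFun t = (t + 1) / 2 * x ^ 2 := by
    unfold lcFun
    rw [hx]
    field_simp
    ring
  have hJ : jsFun t = (t + 1) / 2 *
      ((1 + x) * Real.log (1 + x) + (1 - x) * Real.log (1 - x)) := by
    unfold jsFun
    rw [ep, em]
    field_simp
  have hb : x ^ 2 ≤ (1 + x) * Real.log (1 + x) + (1 - x) * Real.log (1 - x) ∧
      (1 + x) * Real.log (1 + x) + (1 - x) * Real.log (1 - x) ≤ 2 * Real.log 2 * x ^ 2 := by
    rcases le_total 0 x with h | h
    · exact one_add_mul_log_bounds h (by rw [hx, div_le_one htp]; linarith)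
    · have := one_add_mul_log_bounds (x := -x) (by linarith) (by
        have : 0 ≤ 1 + x := by rw [ep]; positivity
        linarith)
      rw [neg_sq, sub_neg_eq_add, ← sub_eq_add_neg] at this
      rwa [add_comm ((1 + x) * _)]
  have h2 : 0 ≤ (t + 1) / 2 := by positivity
  rw [hL, hJ]
  refine ⟨mul_le_mul_of_nonneg_left hb.1 h2, ?_⟩
  calc _ ≤ _ := mul_le_mul_of_nonneg_left hb.2 h2
    _ = _ := by ring

/-! ### The logarithmic Sobolev inequality on two points -/

theorem klHlFactor_mul (p : ℝ) (hp : 0 < p) (hp2 : p ≤ 1 / 2) :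
    klHlFactor p * (1 - 2 * p) = Real.log (1 - p) - Real.log p := by
  unfold klHlFactor
  split_ifs with h
  · subst h
    norm_num
  · have : 1 - 2 * p ≠ 0 := fun h' => h (by linarith)
    rw [div_mul_cancel₀ _ this, ← Real.log_div (by linarith) hp.ne']
    congr 1
    field_simp

theorem sinh_half_logit {a : ℝ} (h0 : 0 < a) (h1 : a < 1) :
    2 * Real.sinh ((Real.log (1 - a) - Real.log a) / 2) = (1 - 2 * a) / √(a * (1 - a)) := by
  have hq : 0 < 1 - a := by linarith
  have hsa := Real.sqrt_pos.mpr h0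
  have hsq := Real.sqrt_pos.mpr hq
  have e : (Real.log (1 - a) - Real.log a) / 2 = Real.log (√(1 - a) / √a) := by
    rw [Real.log_div hsq.ne' hsa.ne', Real.log_sqrt hq.le, Real.log_sqrt h0.le]
    ring
  rw [e, Real.sinh_log (by positivity), Real.sqrt_mul h0.le, inv_div]
  field_simp
  rw [Real.sq_sqrt h0.le, Real.sq_sqrt hq.le]
  ring

theorem half_logit_le_half_logit {a b : ℝ} (h0 : 0 < a) (hab : a ≤ b) (hb : b < 1) :
    (Real.log (1 - b) - Real.log b) / 2 ≤ (Real.log (1 - a) - Real.log a) / 2 := by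
  have h1 := Real.log_le_log h0 hab
  have h2 := Real.log_le_log (by linarith : 0 < 1 - b) (by linarith : 1 - b ≤ 1 - a)
  linarith

theorem half_logit_nonneg {a : ℝ} (h0 : 0 < a) (ha : a ≤ 1 / 2) :
    0 ≤ (Real.log (1 - a) - Real.log a) / 2 := by
  have h2 := Real.log_le_log h0 (by linarith : a ≤ 1 - a)
  linarith

/-- The factor is calibrated so that `z` and `klHlFactor p * √(p(1-p)) * sinh z` agree at the
half-logit of `p`. Monotonicity of `sinh z / z` then decides the sign on either side. -/
theorem sinh_comparison {p : ℝ} (hp : 0 < p) (hp2 : p ≤ 1 / 2) {z : ℝ} (hz : 0 ≤ z) :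
    ((Real.log (1 - p) - Real.log p) / 2 ≤ z →
      z ≤ klHlFactor p * √(p * (1 - p)) * Real.sinh z) ∧
    (z ≤ (Real.log (1 - p) - Real.log p) / 2 →
      klHlFactor p * √(p * (1 - p)) * Real.sinh z ≤ z) := by
  rcases hp2.eq_or_lt with rfl | hlt
  · have e : klHlFactor (1 / 2) * √(1 / 2 * (1 - 1 / 2)) = 1 := by
      have : √(1 / 2 * (1 - 1 / 2) : ℝ) = 1 / 2 := by
        rw [show (1 / 2 * (1 - 1 / 2) : ℝ) = (1 / 2) ^ 2 by norm_num,
          Real.sqrt_sq (by norm_num)]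
      rw [this, klHlFactor, if_pos rfl]
      norm_num
    rw [e, one_mul]
    refine ⟨fun _ => Real.self_le_sinh_iff.mpr hz, fun h => ?_⟩
    have hz0 : z = 0 := le_antisymm (by norm_num at h; exact h) hz
    simp [hz0]
  · set w := (Real.log (1 - p) - Real.log p) / 2 with hw
    have hw0 : 0 < w := by
      have := Real.log_lt_log hp (by linarith : p < 1 - p)
      rw [hw]; linarith
    have hs : 0 < Real.sinh w := Real.sinh_pos_iff.mpr hw0
    have hpq : 0 < √(p * (1 - p)) := Real.sqrt_pos.mpr (mul_pos hp (by linarith))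
    have key : klHlFactor p * √(p * (1 - p)) * Real.sinh w = w := by
      have h1 := sinh_half_logit hp (by linarith)
      rw [eq_div_iff hpq.ne', ← hw] at h1
      have h2 := klHlFactor_mul p hp hp2
      rw [← h1] at h2
      linarith
    constructor
    · intro h
      have h1 := mul_sinh_le hw0.le h
      refine le_of_mul_le_mul_right ?_ hs
      calc z * Real.sinh w ≤ w * Real.sinh z := h1
        _ = _ := by linear_combination -Real.sinh z * key
    · intro h
      have h1 := mul_sinh_le hz h
      refine le_of_mul_le_mul_right ?_ hs
      calc _ = w * Real.sinh z := by linear_combination Real.sinh z * key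
        _ ≤ _ := h1

/-- `C (1 - BC²) - KL` for the Bernoulli laws of parameters `a` and `p`, where `BC` is the
Bhattacharyya coefficient and `C = klHlFactor p`. -/
noncomputable def klHlGap (p a : ℝ) : ℝ :=
  klHlFactor p * (1 - a * p - (1 - a) * (1 - p) - 2 * (√(p * (1 - p)) * √(a * (1 - a))))
    + Real.binEntropy a + a * Real.log p + (1 - a) * Real.log (1 - p)

/-- Under `a ↦ 1 - a` the Hellinger part changes by `klHlFactor p (1 - 2p)(1 - 2a)` and the
logarithmic part by `(1 - 2a)(log p - log (1 - p))`; the definition of the factor makes these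
cancel. -/
theorem klHlGap_one_sub {p : ℝ} (hp : 0 < p) (hp2 : p ≤ 1 / 2) (a : ℝ) :
    klHlGap p (1 - a) = klHlGap p a := by
  have h := klHlFactor_mul p hp hp2
  have e : (1 - a) * (1 - (1 - a)) = a * (1 - a) := by ring
  unfold klHlGap
  rw [Real.binEntropy_one_sub, e]
  linear_combination (1 - 2 * a) * h

theorem klHlGap_self {p : ℝ} (hp : 0 < p) (hp2 : p ≤ 1 / 2) : klHlGap p p = 0 := by
  unfold klHlGap
  rw [Real.mul_self_sqrt (mul_nonneg hp.le (by linarith)), Real.binEntropy, Real.log_inv,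
    Real.log_inv]
  ring

theorem klHlGap_continuous (p : ℝ) : Continuous (klHlGap p) := by
  unfold klHlGap
  fun_prop

theorem klHlGap_hasDerivAt {p : ℝ} (hp : 0 < p) (hp2 : p ≤ 1 / 2) {a : ℝ} (h0 : 0 < a)
    (h1 : a < 1) :
    HasDerivAt (klHlGap p) (2 * ((Real.log (1 - a) - Real.log a) / 2 -
      klHlFactor p * √(p * (1 - p)) * Real.sinh ((Real.log (1 - a) - Real.log a) / 2))) a := by
  have hpos : 0 < a * (1 - a) := mul_pos h0 (by linarith)
  have hd0 : HasDerivAt (fun a : ℝ => a * (1 - a)) (1 - 2 * a) a := by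
    convert! (hasDerivAt_id a).mul ((hasDerivAt_id a).const_sub 1) using 1
    simp; ring
  have hd1 := hd0.sqrt hpos.ne'
  have hd2 : HasDerivAt (fun a : ℝ => 1 - a * p - (1 - a) * (1 - p)) (1 - 2 * p) a := by
    convert! (((hasDerivAt_id a).mul_const p).const_sub 1).sub
      (((hasDerivAt_id a).const_sub 1).mul_const (1 - p)) using 1
    ring
  have hd3 := (hd2.sub ((hd1.const_mul √(p * (1 - p))).const_mul 2)).const_mul (klHlFactor p)
  have hd4 := ((hd3.add (Real.hasDerivAt_binEntropy h0.ne' h1.ne)).add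
    ((hasDerivAt_id a).mul_const (Real.log p))).add
    (((hasDerivAt_id a).const_sub 1).mul_const (Real.log (1 - p)))
  convert! hd4 using 1
  have h := klHlFactor_mul p hp hp2
  have hs := sinh_half_logit h0 h1
  have e : (1 - 2 * a) / (2 * √(a * (1 - a))) =
      Real.sinh ((Real.log (1 - a) - Real.log a) / 2) := by
    rw [mul_comm 2 √(a * (1 - a)), ← div_div, ← hs]
    ring
  rw [e]
  linear_combination -h

/-- By symmetry take `a ≤ 1/2`. There the gap decreases up to `p`, where it vanishes, and increases
afterwards. -/
theorem klHlGap_nonneg {p : ℝ} (hp : 0 < p) (hp2 : p ≤ 1 / 2) {a : ℝ} (h0 : 0 ≤ a)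
    (h1 : a ≤ 1) : 0 ≤ klHlGap p a := by
  wlog ha : a ≤ 1 / 2 generalizing a
  · rw [← klHlGap_one_sub hp hp2]
    exact this (by linarith) (by linarith) (by linarith)
  rw [← klHlGap_self hp hp2]
  rcases le_total a p with hap | hap
  · refine ge_of_hasDerivAt_nonpos hap (klHlGap_continuous p).continuousOn
      (fun t ht => klHlGap_hasDerivAt hp hp2 (h0.trans_lt ht.1) (by linarith [ht.2])) ?_
    intro t ht
    have ht0 := h0.trans_lt ht.1
    have := (sinh_comparison hp hp2 (half_logit_nonneg ht0 (by linarith [ht.2]))).1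
      (half_logit_le_half_logit ht0 ht.2.le (by linarith))
    linarith
  · refine le_of_hasDerivAt_nonneg hap (klHlGap_continuous p).continuousOn
      (fun t ht => klHlGap_hasDerivAt hp hp2 (hp.trans ht.1) (by linarith [ht.2])) ?_
    intro t ht
    have := (sinh_comparison hp hp2 (half_logit_nonneg (hp.trans ht.1) (by linarith [ht.2]))).2
      (half_logit_le_half_logit hp ht.1.le (by linarith [ht.2]))
    linarith

/-- This is `klHlGap_nonneg` at `a = p B²`: `A²` and `B²` are the values of the density of one
Bernoulli law with respect to another. -/
theorem two_point_log_sobolev {p A B : ℝ} (hp : 0 < p) (hp2 : p ≤ 1 / 2) (hA : 0 ≤ A)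
    (hB : 0 < B) (h1 : p * B ^ 2 + (1 - p) * A ^ 2 = 1) :
    2 * (p * B ^ 2 * Real.log B + (1 - p) * A ^ 2 * Real.log A) ≤
      klHlFactor p * (1 - (p * B + (1 - p) * A) ^ 2) := by
  have hq : 0 < 1 - p := by linarith
  have ha : 1 - p * B ^ 2 = (1 - p) * A ^ 2 := by linarith
  have hg := klHlGap_nonneg hp hp2 (a := p * B ^ 2) (by positivity) (by
    have : 0 ≤ (1 - p) * A ^ 2 := by positivity
    linarith)
  have hs : √(p * (1 - p)) * √(p * B ^ 2 * ((1 - p) * A ^ 2)) = p * (1 - p) * (A * B) := by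
    rw [← Real.sqrt_mul (by positivity), show p * (1 - p) * (p * B ^ 2 * ((1 - p) * A ^ 2)) =
      (p * (1 - p) * (A * B)) ^ 2 by ring, Real.sqrt_sq (by positivity)]
  have hb : p * B ^ 2 * Real.log (p * B ^ 2) =
      p * B ^ 2 * Real.log p + 2 * (p * B ^ 2 * Real.log B) := by
    rw [Real.log_mul hp.ne' (by positivity), Real.log_pow]
    push_cast
    ring
  have ha' : (1 - p) * A ^ 2 * Real.log ((1 - p) * A ^ 2) =
      (1 - p) * A ^ 2 * Real.log (1 - p) + 2 * ((1 - p) * A ^ 2 * Real.log A) := by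
    rcases hA.eq_or_lt with rfl | hA
    · simp
    rw [Real.log_mul hq.ne' (by positivity), Real.log_pow]
    push_cast
    ring
  unfold klHlGap at hg
  rw [Real.binEntropy, Real.log_inv, Real.log_inv, ha, hs] at hg
  have e : 1 - p * B ^ 2 * p - (1 - p) * A ^ 2 * (1 - p) - 2 * (p * (1 - p) * (A * B)) =
      1 - (p * B + (1 - p) * A) ^ 2 := by ring
  rw [e] at hg
  linarith

/-! ### Quadratic majorants of `t² log t` -/

theorem sq_mul_log_hasDerivAt {x : ℝ} (hx : 0 < x) :
    HasDerivAt (fun u => u ^ 2 * Real.log u - (u - 1)) (2 * x * Real.log x + x - 1) x := by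
  convert! ((hasDerivAt_pow 2 x).mul (Real.hasDerivAt_log hx.ne')).sub
    ((hasDerivAt_id x).sub_const 1) using 1
  field_simp
  norm_num
  ring

/-- The remainder of `u² log u` after its second-order Taylor polynomial at `1` is increasing, with
derivative `2 (u log u - (u - 1)) ≥ 0`, and vanishes at `1`. -/
theorem sq_mul_log_sub_mono {u v : ℝ} (hu : 0 < u) (huv : u ≤ v) :
    u ^ 2 * Real.log u - (u - 1) - 3 / 2 * (u - 1) ^ 2 ≤
      v ^ 2 * Real.log v - (v - 1) - 3 / 2 * (v - 1) ^ 2 := by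
  have hd : ∀ x, 0 < x → HasDerivAt
      (fun u => u ^ 2 * Real.log u - (u - 1) - 3 / 2 * (u - 1) ^ 2)
      (2 * (x * Real.log x - (x - 1))) x := by
    intro x hx
    convert! (sq_mul_log_hasDerivAt hx).sub
      ((((hasDerivAt_id x).sub_const 1).pow 2).const_mul (3 / 2)) using 1
    norm_num
    ring
  refine le_of_hasDerivAt_nonneg
    (F := fun u => u ^ 2 * Real.log u - (u - 1) - 3 / 2 * (u - 1) ^ 2) huv
    (fun x hx => (hd x (hu.trans_le hx.1)).continuousAt.continuousWithinAt)
    (fun x hx => hd x (hu.trans hx.1)) ?_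
  intro x hx
  linarith [Real.self_sub_one_le_mul_log (hu.trans hx.1).le]

theorem sq_mul_log_le_of_le {b u : ℝ} (hb : 1 < b) (hu0 : 0 ≤ u) (hub : u ≤ b) :
    u ^ 2 * Real.log u ≤
      (u - 1) + (b ^ 2 * Real.log b - (b - 1)) / (b - 1) ^ 2 * (u - 1) ^ 2 := by
  have hb' : 0 < (b - 1) ^ 2 := by have : 0 < b - 1 := by linarith
                                   positivity
  have hk : 3 / 2 ≤ (b ^ 2 * Real.log b - (b - 1)) / (b - 1) ^ 2 := by
    rw [le_div_iff₀ hb']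
    have := sq_mul_log_sub_mono one_pos hb.le
    norm_num at this
    linarith
  rcases le_or_gt u 1 with h | h
  · have h1 : u ^ 2 * Real.log u - (u - 1) ≤ 3 / 2 * (u - 1) ^ 2 := by
      rcases hu0.eq_or_lt with rfl | hu
      · norm_num
      have := sq_mul_log_sub_mono hu h
      norm_num at this
      linarith
    nlinarith [mul_le_mul_of_nonneg_right hk (sq_nonneg (u - 1))]
  · have hu' : 0 < (u - 1) ^ 2 := by have : 0 < u - 1 := by linarith
                                     positivity
    -- Beyond `1` the smallest admissible coefficient at `u` is this quotient. It increases, so its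
    -- value at `b` serves for all `u ≤ b`.
    have hd : ∀ x, 1 < x → HasDerivAt (fun u => (u ^ 2 * Real.log u - (u - 1)) / (u - 1) ^ 2)
        ((x - x⁻¹ - 2 * Real.log x) * (x * (x - 1)) / ((x - 1) ^ 2) ^ 2) x := by
      intro x hx
      have hx1 : x - 1 ≠ 0 := by linarith
      have hx0 : x ≠ 0 := by linarith
      convert! (sq_mul_log_hasDerivAt (by linarith : 0 < x)).div
        (((hasDerivAt_id x).sub_const 1).pow 2) (pow_ne_zero 2 hx1) using 1
      norm_num
      field_simp
      ring
    have hm := le_of_hasDerivAt_nonneg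
      (F := fun u => (u ^ 2 * Real.log u - (u - 1)) / (u - 1) ^ 2) hub
      (fun x hx => (hd x (h.trans_le hx.1)).continuousAt.continuousWithinAt)
      (fun x hx => hd x (h.trans hx.1)) (fun x hx => by
        have hx1 := h.trans hx.1
        have := two_mul_log_le_sub_inv hx1.le
        apply div_nonneg _ (by positivity)
        apply mul_nonneg (by linarith)
        nlinarith)
    rw [div_le_iff₀ hu'] at hm
    linarith

/-- Among quadratics touching `t² log t` at `A` to first order, the one through `B > A` is a
majorant on `[0, B]`. -/
theorem exists_quadratic_majorant {A B : ℝ} (hA : 0 ≤ A) (hAB : A < B) :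
    ∃ k : ℝ, (∀ t, 0 ≤ t → t ≤ B →
        t ^ 2 * Real.log t ≤ t ^ 2 * Real.log A + A * (t - A) + k * (t - A) ^ 2) ∧
      k * (B - A) ^ 2 = B ^ 2 * (Real.log B - Real.log A) - A * (B - A) := by
  -- At `A = 0` the convention `Real.log 0 = 0` reduces the majorant to `t² log B`.
  rcases hA.eq_or_lt with rfl | hA
  · refine ⟨Real.log B, fun t ht htB => ?_, by simp; ring⟩
    rcases ht.eq_or_lt with rfl | ht
    · simp
    have := mul_le_mul_of_nonneg_left (Real.log_le_log ht htB) (sq_nonneg t)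
    simp
    linarith
  have hB : 0 < B := hA.trans hAB
  have hb : 1 < B / A := (one_lt_div hA).mpr hAB
  refine ⟨((B / A) ^ 2 * Real.log (B / A) - (B / A - 1)) / (B / A - 1) ^ 2,
    fun t ht htB => ?_, ?_⟩
  · rcases ht.eq_or_lt with rfl | ht
    · have h := sq_mul_log_le_of_le hb le_rfl (by positivity)
      norm_num at h ⊢
      nlinarith [mul_le_mul_of_nonneg_left h (sq_nonneg A)]
    have h := mul_le_mul_of_nonneg_left (sq_mul_log_le_of_le hb (u := t / A) (by positivity)
      (by gcongr)) (sq_nonneg A)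
    rw [Real.log_div ht.ne' hA.ne'] at h
    have e1 : A ^ 2 * ((t / A) ^ 2 * (Real.log t - Real.log A)) =
        t ^ 2 * Real.log t - t ^ 2 * Real.log A := by field_simp
    have e2 : A ^ 2 * (t / A - 1) = A * (t - A) := by field_simp
    have e3 : A ^ 2 * (t / A - 1) ^ 2 = (t - A) ^ 2 := by field_simp
    rw [e1, mul_add, e2, mul_left_comm, e3] at h
    linarith
  · have h1 : B / A - 1 ≠ 0 := by linarith
    have e3 : (B - A) ^ 2 = A ^ 2 * (B / A - 1) ^ 2 := by field_simp
    rw [e3, ← mul_assoc, mul_right_comm, div_mul_cancel₀ _ (pow_ne_zero 2 h1),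
      Real.log_div hB.ne' hA.ne']
    field_simp

/-! ### Divergences of a square-integrable probability density -/

section
variable {Ω : Type*} [MeasurableSpace Ω] {ν : Measure Ω} {r : Ω → ℝ}

/-- Cauchy--Schwarz in the form `(∫ |w|)² ≤ ∫ U · ∫ V` when `w² ≤ U V`. -/
theorem sq_integral_abs_le {w U V : Ω → ℝ} (hw : Integrable w ν) (hU : Integrable U ν)
    (hV : Integrable V ν) (hU0 : ∀ᵐ x ∂ν, 0 ≤ U x) (hV0 : ∀ᵐ x ∂ν, 0 ≤ V x)
    (h : ∀ᵐ x ∂ν, w x ^ 2 ≤ U x * V x) :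
    (∫ x, |w x| ∂ν) ^ 2 ≤ (∫ x, U x ∂ν) * ∫ x, V x ∂ν := by
  -- A quadratic in `s` that is nonnegative everywhere has nonpositive discriminant.
  have key : ∀ s : ℝ, 0 ≤ (∫ x, U x ∂ν) * (s * s) + (-2 * ∫ x, |w x| ∂ν) * s + ∫ x, V x ∂ν := by
    intro s
    have e : (∫ x, U x ∂ν) * (s * s) + (-2 * ∫ x, |w x| ∂ν) * s + ∫ x, V x ∂ν =
        ∫ x, (U x * (s * s) + (-2 * |w x|) * s + V x) ∂ν := by
      have h1 : Integrable (fun x => U x * (s * s)) ν := hU.mul_const _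
      have h2 : Integrable (fun x => -2 * |w x| * s) ν := (hw.abs.const_mul _).mul_const _
      rw [integral_add (f := fun x => U x * (s * s) + -2 * |w x| * s) (h1.add h2) hV,
        integral_add h1 h2, integral_mul_const, integral_mul_const, integral_const_mul]
    rw [e]
    refine integral_nonneg_of_ae ?_
    filter_upwards [hU0, hV0, h] with x h1 h2 h3
    have h4 : 2 * s * |w x| ≤ U x * (s * s) + V x := by
      refine le_of_abs_le (abs_le_of_sq_le_sq ?_ (add_nonneg (mul_nonneg h1 (mul_self_nonneg s)) h2))
      have h5 : (2 * s * |w x|) ^ 2 = 4 * s ^ 2 * w x ^ 2 := by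
        rw [mul_pow, sq_abs]
        ring
      rw [h5]
      nlinarith [mul_le_mul_of_nonneg_left h3 (sq_nonneg s), sq_nonneg (U x * (s * s) - V x)]
    simp only [Pi.zero_apply]
    linarith
  have := discrim_le_zero key
  unfold discrim at this
  linarith

theorem integral_tvFun (ν : Measure Ω) (r : Ω → ℝ) : ∫ x, tvFun (r x) ∂ν = (∫ x, |r x - 1| ∂ν) / 2 := by
  unfold tvFun
  rw [integral_div]

theorem integral_tvFun_nonneg (ν : Measure Ω) (r : Ω → ℝ) : 0 ≤ ∫ x, tvFun (r x) ∂ν :=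
  integral_nonneg fun x => by unfold tvFun; positivity

theorem integral_chiSqFun_nonneg (ν : Measure Ω) (r : Ω → ℝ) : 0 ≤ ∫ x, chiSqFun (r x) ∂ν :=
  integral_nonneg fun x => by unfold chiSqFun; positivity

theorem integral_hlFun_nonneg (ν : Measure Ω) (r : Ω → ℝ) : 0 ≤ ∫ x, hlFun (r x) ∂ν :=
  integral_nonneg fun x => by unfold hlFun; positivity

theorem abs_lcFun_le {t : ℝ} (ht : 0 ≤ t) : |lcFun t| ≤ 2 * (1 + t ^ 2) := by
  have h0 : 0 ≤ lcFun t := by unfold lcFun; positivity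
  rw [abs_of_nonneg h0]
  refine (lcFun_le_hlFun ht).trans ((hlFun_le_abs ht).trans ?_)
  rw [abs_le]
  constructor <;> nlinarith [sq_nonneg (t - 1)]

/-- `r` is a probability density with respect to `ν` that lies in `L²(ν)`. -/
structure IsSqDensity (ν : Measure Ω) (r : Ω → ℝ) : Prop where
  memLp : MemLp r 2 ν
  nonneg : ∀ᵐ x ∂ν, 0 ≤ r x
  integral_eq_one : ∫ x, r x ∂ν = 1

namespace IsSqDensity

theorem integrable [IsProbabilityMeasure ν] (hr : IsSqDensity ν r) : Integrable r ν := hr.memLp.integrable (by norm_num)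

theorem integrable_comp [IsProbabilityMeasure ν] (hr : IsSqDensity ν r) {f : ℝ → ℝ} (hf : Measurable f) (C : ℝ)
    (hC : ∀ t, 0 ≤ t → |f t| ≤ C * (1 + t ^ 2)) : Integrable (fun x => f (r x)) ν := by
  refine (((integrable_const (1 : ℝ)).add hr.memLp.integrable_sq).const_mul C).mono'
    (hf.comp_aemeasurable hr.memLp.aestronglyMeasurable.aemeasurable).aestronglyMeasurable ?_
  filter_upwards [hr.nonneg] with x hx
  exact hC _ hx

theorem integral_comp_le (hr : IsSqDensity ν r) {f g : ℝ → ℝ} (hf : Integrable (fun x => f (r x)) ν)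
    (hg : Integrable (fun x => g (r x)) ν) (h : ∀ t, 0 ≤ t → f t ≤ g t) :
    ∫ x, f (r x) ∂ν ≤ ∫ x, g (r x) ∂ν := by
  refine integral_mono_ae hf hg ?_
  filter_upwards [hr.nonneg] with x hx
  exact h _ hx

theorem integrable_sqrt [IsProbabilityMeasure ν] (hr : IsSqDensity ν r) : Integrable (fun x => √(r x)) ν := by
  refine hr.integrable_comp (by fun_prop) 1 fun t ht => ?_
  rw [abs_of_nonneg (Real.sqrt_nonneg t)]
  nlinarith [Real.sq_sqrt ht, sq_nonneg (√t - 1), sq_nonneg (t - 1), Real.sqrt_nonneg t]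

theorem integrable_tvFun [IsProbabilityMeasure ν] (hr : IsSqDensity ν r) : Integrable (fun x => tvFun (r x)) ν := by
  refine hr.integrable_comp (by unfold tvFun; fun_prop) 1 fun t ht => ?_
  unfold tvFun
  rw [abs_of_nonneg (by positivity)]
  have : |t - 1| ≤ t + 1 := by rw [abs_le]; constructor <;> linarith
  nlinarith [sq_nonneg (t - 1)]

theorem integrable_hlFun [IsProbabilityMeasure ν] (hr : IsSqDensity ν r) : Integrable (fun x => hlFun (r x)) ν := by
  refine hr.integrable_comp (by unfold hlFun; fun_prop) 2 fun t ht => ?_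
  have h0 : 0 ≤ hlFun t := by unfold hlFun; positivity
  rw [abs_of_nonneg h0]
  refine (hlFun_le_abs ht).trans ?_
  rw [abs_le]
  constructor <;> nlinarith [sq_nonneg (t - 1)]

theorem integrable_klFun [IsProbabilityMeasure ν] (hr : IsSqDensity ν r) : Integrable (fun x => klFun (r x)) ν := by
  refine hr.integrable_comp (by unfold klFun; fun_prop) 1 fun t ht => ?_
  unfold klFun
  have h1 := Real.self_sub_one_le_mul_log ht
  have h2 : t * Real.log t ≤ t ^ 2 := by
    rcases ht.eq_or_lt with rfl | ht
    · simp
    nlinarith [Real.log_le_sub_one_of_pos ht]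
  rw [abs_le]
  constructor <;> nlinarith [sq_nonneg t]

theorem integrable_chiSqFun [IsProbabilityMeasure ν] (hr : IsSqDensity ν r) : Integrable (fun x => chiSqFun (r x)) ν := by
  refine hr.integrable_comp (by unfold chiSqFun; fun_prop) 2 fun t ht => ?_
  unfold chiSqFun
  rw [abs_of_nonneg (by positivity)]
  nlinarith [sq_nonneg (t + 1)]

theorem integrable_lcFun [IsProbabilityMeasure ν] (hr : IsSqDensity ν r) : Integrable (fun x => lcFun (r x)) ν :=
  hr.integrable_comp (by unfold lcFun; fun_prop) 2 fun _ ht => abs_lcFun_le ht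

theorem integrable_jsFun [IsProbabilityMeasure ν] (hr : IsSqDensity ν r) : Integrable (fun x => jsFun (r x)) ν := by
  refine hr.integrable_comp (by unfold jsFun; fun_prop) (2 * Real.log 2 * 2) fun t ht => ?_
  have h0 : 0 ≤ lcFun t := by unfold lcFun; positivity
  obtain ⟨h1, h2⟩ := lcFun_le_jsFun_le ht
  rw [abs_of_nonneg (h0.trans h1), mul_assoc]
  refine h2.trans (mul_le_mul_of_nonneg_left ?_ (by positivity))
  exact (le_abs_self _).trans (abs_lcFun_le ht)

theorem integral_affine_add [IsProbabilityMeasure ν] (hr : IsSqDensity ν r) {F : Ω → ℝ} (hF : Integrable F ν) (a b c : ℝ) :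
    ∫ x, (a + b * r x + c * F x) ∂ν = a + b + c * ∫ x, F x ∂ν := by
  rw [integral_add (f := fun x => a + b * r x)
      ((integrable_const a).add (hr.integrable.const_mul b)) (hF.const_mul c),
    integral_add (integrable_const a) (hr.integrable.const_mul b), integral_const_mul,
    integral_const_mul, hr.integral_eq_one]
  simp

theorem integrable_affine_add [IsProbabilityMeasure ν] (hr : IsSqDensity ν r) {F : Ω → ℝ} (hF : Integrable F ν) (a b c : ℝ) :
    Integrable (fun x => a + b * r x + c * F x) ν :=
  ((integrable_const a).add (hr.integrable.const_mul b)).add (hF.const_mul c)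

/-- A pointwise bound `a + b t + c f(t) ≤ g(t)` integrates to a bound between divergences. -/
theorem affine_add_integral_le [IsProbabilityMeasure ν] (hr : IsSqDensity ν r) {f g : ℝ → ℝ} (hf : Integrable (fun x => f (r x)) ν)
    (hg : Integrable (fun x => g (r x)) ν) (a b c : ℝ)
    (h : ∀ t, 0 ≤ t → a + b * t + c * f t ≤ g t) :
    a + b + c * ∫ x, f (r x) ∂ν ≤ ∫ x, g (r x) ∂ν := by
  rw [← hr.integral_affine_add hf]
  exact hr.integral_comp_le (f := fun t => a + b * t + c * f t)
    (hr.integrable_affine_add hf a b c) hg h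

theorem integral_sqrt_pos [IsProbabilityMeasure ν] (hr : IsSqDensity ν r) : 0 < ∫ x, √(r x) ∂ν := by
  refine lt_of_le_of_ne (integral_nonneg fun x => Real.sqrt_nonneg _) fun h => ?_
  have h0 := (integral_eq_zero_iff_of_nonneg (fun x => Real.sqrt_nonneg (r x))
    hr.integrable_sqrt).mp h.symm
  have : ∫ x, r x ∂ν = ∫ _, (0 : ℝ) ∂ν := by
    refine integral_congr_ae ?_
    filter_upwards [h0, hr.nonneg] with x h1 h2
    exact (Real.sqrt_eq_zero h2).mp h1
  rw [hr.integral_eq_one] at this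
  simp at this

theorem integral_hlFun [IsProbabilityMeasure ν] (hr : IsSqDensity ν r) : ∫ x, hlFun (r x) ∂ν = 2 - 2 * ∫ x, √(r x) ∂ν := by
  have : ∫ x, hlFun (r x) ∂ν = ∫ x, (1 + 1 * r x + (-2) * √(r x)) ∂ν := by
    refine integral_congr_ae ?_
    filter_upwards [hr.nonneg] with x hx
    unfold hlFun
    linear_combination Real.sq_sqrt hx
  rw [this, hr.integral_affine_add hr.integrable_sqrt]
  ring

/-- Cauchy–Schwarz applied to `|r - 1| = |√r - 1| (√r + 1)`; with `m = ∫ √r`, the two squares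
integrate to `2 - 2m` and `2 + 2m`. -/
theorem tv_sq_le [IsProbabilityMeasure ν] (hr : IsSqDensity ν r) : (∫ x, tvFun (r x) ∂ν) ^ 2 ≤ 1 - (∫ x, √(r x) ∂ν) ^ 2 := by
  have hi : Integrable (fun x => (√(r x) + 1) ^ 2) ν := by
    refine (hr.integrable_affine_add hr.integrable_sqrt 1 1 2).congr ?_
    filter_upwards [hr.nonneg] with x hx
    linear_combination -Real.sq_sqrt hx
  have hv : ∫ x, (√(r x) + 1) ^ 2 ∂ν = 2 + 2 * ∫ x, √(r x) ∂ν := by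
    have : ∫ x, (√(r x) + 1) ^ 2 ∂ν = ∫ x, (1 + 1 * r x + 2 * √(r x)) ∂ν := by
      refine integral_congr_ae ?_
      filter_upwards [hr.nonneg] with x hx
      linear_combination Real.sq_sqrt hx
    rw [this, hr.integral_affine_add hr.integrable_sqrt]
    ring
  have h := sq_integral_abs_le (w := fun x => r x - 1) (hr.integrable.sub (integrable_const 1))
    hr.integrable_hlFun hi (ae_of_all _ fun x => by unfold hlFun; positivity)
    (ae_of_all _ fun x => by positivity) (by
      filter_upwards [hr.nonneg] with x hx
      unfold hlFun
      rw [← mul_pow]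
      apply le_of_eq
      congr 1
      linear_combination -Real.sq_sqrt hx)
  rw [hv, hr.integral_hlFun] at h
  rw [integral_tvFun ν r]
  linarith

theorem tv_lt_one [IsProbabilityMeasure ν] (hr : IsSqDensity ν r) : ∫ x, tvFun (r x) ∂ν < 1 := by
  nlinarith [hr.tv_sq_le, hr.integral_sqrt_pos, integral_tvFun_nonneg ν r]

theorem tv_sq_le_kl [IsProbabilityMeasure ν] (hr : IsSqDensity ν r) : (∫ x, tvFun (r x) ∂ν) ^ 2 ≤ 1 / 2 * ∫ x, klFun (r x) ∂ν := by
  have h := sq_integral_abs_le (w := fun x => r x - 1) (hr.integrable.sub (integrable_const 1))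
    (hr.integrable_affine_add hr.integrable_klFun 1 (-1) 1)
    (hr.integrable_affine_add hr.integrable (4 / 3) 0 (2 / 3)) (by
      filter_upwards [hr.nonneg] with x hx
      have := Real.self_sub_one_le_mul_log hx
      unfold klFun
      linarith) (by
      filter_upwards [hr.nonneg] with x hx
      positivity) (by
      filter_upwards [hr.nonneg] with x hx
      have := pinsker_pointwise hx
      unfold klFun
      linarith)
  rw [hr.integral_affine_add hr.integrable_klFun, hr.integral_affine_add hr.integrable,
    hr.integral_eq_one] at h
  rw [integral_tvFun ν r]
  linarith

theorem tv_sq_le_chiSq [IsProbabilityMeasure ν] (hr : IsSqDensity ν r) : (∫ x, tvFun (r x) ∂ν) ^ 2 ≤ 1 / 4 * ∫ x, chiSqFun (r x) ∂ν := by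
  have h := sq_integral_abs_le (w := fun x => r x - 1) (hr.integrable.sub (integrable_const 1))
    hr.integrable_chiSqFun (integrable_const (1 : ℝ))
    (ae_of_all _ fun x => by unfold chiSqFun; positivity) (ae_of_all _ fun x => zero_le_one)
    (ae_of_all _ fun x => by unfold chiSqFun; rw [mul_one])
  rw [integral_tvFun ν r]
  simp at h
  linarith

theorem strong_pinsker [IsProbabilityMeasure ν] (hr : IsSqDensity ν r) : Real.log ((1 + ∫ x, tvFun (r x) ∂ν) / (1 - ∫ x, tvFun (r x) ∂ν)) -
    2 * (∫ x, tvFun (r x) ∂ν) / (1 + ∫ x, tvFun (r x) ∂ν) ≤ ∫ x, klFun (r x) ∂ν := by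
  have h0 := integral_tvFun_nonneg ν r
  have h1 := hr.tv_lt_one
  set T := ∫ x, tvFun (r x) ∂ν with hT
  have hp : 0 < 1 + T := by linarith
  have hm : 0 < 1 - T := by linarith
  -- With this parameter `-log s` is the logarithm in the claim, and the remaining terms add up to
  -- `-2T / (1 + T)`.
  set s := (1 - T) / (1 + T) with hs
  have hs0 : 0 < s := by positivity
  have hs1 : s ≤ 1 := by rw [hs, div_le_one hp]; linarith
  have h := hr.affine_add_integral_le hr.integrable_tvFun hr.integrable_klFun
    (-s⁻¹ + (s⁻¹ - s) / 2) (1 - Real.log s - (s⁻¹ - s) / 2) (s⁻¹ - s) (fun t ht => by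
      have := strong_pinsker_pointwise hs0 hs1 ht
      unfold tvFun klFun
      linarith)
  have hl : Real.log ((1 + T) / (1 - T)) = -Real.log s := by
    rw [← Real.log_inv, hs, inv_div]
  have e : -s⁻¹ + 1 + (s⁻¹ - s) * T = -(2 * T / (1 + T)) := by
    rw [hs, inv_div]
    field_simp
    ring
  rw [hl]
  linarith

theorem tv_div_le_chiSq [IsProbabilityMeasure ν] (hr : IsSqDensity ν r) (hT : 1 / 2 ≤ ∫ x, tvFun (r x) ∂ν) :
    (∫ x, tvFun (r x) ∂ν) / (1 - ∫ x, tvFun (r x) ∂ν) ≤ ∫ x, chiSqFun (r x) ∂ν := by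
  have h1 := hr.tv_lt_one
  set T := ∫ x, tvFun (r x) ∂ν
  have hm : 0 < 1 - T := by linarith
  -- The contact points `0` and `1 + k = 1 / (1 - T)` are the values of the two-point density of
  -- mean one with total variation `T`; `k ≥ 1` is exactly `T ≥ 1/2`.
  set k := T / (1 - T) with hk
  have hk1 : 1 ≤ k := by rw [hk, le_div_iff₀ hm]; linarith
  have h := hr.affine_add_integral_le hr.integrable_tvFun hr.integrable_chiSqFun
    ((1 + k ^ 2) / 2 - k - k ^ 2) (-(1 + k ^ 2) / 2 + k) (1 + k ^ 2 + 2 * k) (fun t ht => by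
      have := chiSq_tv_pointwise hk1 ht
      unfold tvFun chiSqFun
      linarith)
  have e : k * (1 - T) = T := by rw [hk]; field_simp
  have e2 : -k ^ 2 + (1 + k ^ 2 + 2 * k) * T = k := by
    linear_combination (-k - 1) * e
  linarith

/-- Jensen's inequality for `log` under the law `r dν`, applied to `r^(-1/2)`, whose mean there is
`∫ √r dν`; it is carried out with the tangent line at that mean. -/
theorem neg_two_log_le_kl [IsProbabilityMeasure ν] (hr : IsSqDensity ν r) : -2 * Real.log (∫ x, √(r x) ∂ν) ≤ ∫ x, klFun (r x) ∂ν := by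
  have hm := hr.integral_sqrt_pos
  set m := ∫ x, √(r x) ∂ν
  have h := hr.affine_add_integral_le (f := fun t => √t) hr.integrable_sqrt hr.integrable_klFun
    0 (2 - 2 * Real.log m) (-2 / m) (fun t ht => by
      unfold klFun
      rcases ht.eq_or_lt with rfl | ht
      · simp
      have hs := Real.sqrt_pos.mpr ht
      have hl := log_le_div_add_log (inv_pos.mpr hs) hm
      rw [Real.log_inv, Real.log_sqrt ht.le] at hl
      have h2 := mul_le_mul_of_nonneg_left hl ht.le
      have e : t * ((√t)⁻¹ / m) = √t / m := by
        nth_rewrite 1 [← Real.mul_self_sqrt ht.le]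
        field_simp
      rw [mul_add, mul_sub, e] at h2
      have : -2 / m * √t = -2 * (√t / m) := by ring
      rw [this]
      linarith)
  have : -2 / m * m = -2 := by field_simp
  linarith

/-- Jensen's inequality for `log` under `r dν`, applied to `r`, whose mean there is `∫ r² dν = 1 +
X`. -/
theorem kl_le_log_one_add_chiSq [IsProbabilityMeasure ν] (hr : IsSqDensity ν r) :
    ∫ x, klFun (r x) ∂ν ≤ Real.log (1 + ∫ x, chiSqFun (r x) ∂ν) := by
  have hX := integral_chiSqFun_nonneg ν r
  set X := ∫ x, chiSqFun (r x) ∂ν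
  have hc : 0 < 1 + X := by linarith
  have h := hr.affine_add_integral_le hr.integrable_klFun hr.integrable_chiSqFun
    1 ((1 + X) * (1 - Real.log (1 + X)) - 2) (1 + X) (fun t ht => by
      unfold klFun chiSqFun
      rcases ht.eq_or_lt with rfl | ht
      · norm_num
      have hl := log_le_div_add_log ht hc
      have h2 := mul_le_mul_of_nonneg_left hl (mul_nonneg hc.le ht.le)
      have e : (1 + X) * t * (t / (1 + X)) = t ^ 2 := by field_simp
      rw [mul_add, mul_sub, e] at h2
      linarith)
  have : (1 + X) * ∫ x, klFun (r x) ∂ν ≤ (1 + X) * Real.log (1 + X) := by linarith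
  exact le_of_mul_le_mul_left this hc

end IsSqDensity

/-! ### The logarithmic Sobolev inequality for bounded densities -/

/-- Comparison with the two-point law whose larger value is the upper bound `m + b` of `√r`. -/
theorem IsSqDensity.kl_le_of_sqrt_le [IsProbabilityMeasure ν] (hr : IsSqDensity ν r) {p b : ℝ}
    (hp : 0 < p) (hp2 : p ≤ 1 / 2) (hb : 0 ≤ b)
    (hbV : p * b ^ 2 = (1 - (∫ x, √(r x) ∂ν) ^ 2) * (1 - p))
    (hle : ∀ᵐ x ∂ν, √(r x) ≤ ∫ x, √(r x) ∂ν + b) :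
    ∫ x, klFun (r x) ∂ν ≤ klHlFactor p * (1 - (∫ x, √(r x) ∂ν) ^ 2) := by
  have hm := hr.integral_sqrt_pos
  set m := ∫ x, √(r x) ∂ν with hmdef
  have hq : 0 < 1 - p := by linarith
  rcases hb.eq_or_lt with rfl | hb
  · have hV : 1 - m ^ 2 = 0 := by
      have : (1 - m ^ 2) * (1 - p) = 0 := by linarith
      exact (mul_eq_zero.mp this).resolve_right hq.ne'
    have hm1 : m = 1 := by nlinarith
    have h0 := (integral_eq_zero_iff_of_nonneg (fun x => by unfold hlFun; positivity)
      hr.integrable_hlFun).mp (by rw [hr.integral_hlFun, ← hmdef, hm1]; ring)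
    have : ∫ x, klFun (r x) ∂ν = ∫ _, (0 : ℝ) ∂ν := by
      refine integral_congr_ae ?_
      filter_upwards [h0, hr.nonneg] with x h1 h2
      have h3 : √(r x) = 1 := by
        have : (√(r x) - 1) ^ 2 = 0 := h1
        have := pow_eq_zero_iff (two_ne_zero) |>.mp this
        linarith
      have h4 : r x = 1 := Real.sqrt_eq_one.mp h3
      simp [klFun, h4]
    rw [this, hV]
    simp
  -- Mass `p` at `B` and `1 - p` at `A` gives a law with the mean `m` and second moment `1` of `√r`.
  set A := m - b * p / (1 - p) with hA
  set B := m + b with hB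
  have hV : (1 - p) * (m - A) * b = (1 - m ^ 2) * (1 - p) := by
    rw [hA, ← hbV]
    field_simp
    ring
  have hA0 : 0 ≤ A := by
    -- Integrating `√r (B - √r) ≥ 0` gives `m B ≥ 1`, and `A b = m B - 1`.
    have h1 : 0 ≤ ∫ x, (0 + (-1) * r x + B * √(r x)) ∂ν := by
      apply integral_nonneg_of_ae
      filter_upwards [hr.nonneg, hle] with x h1 h2
      have := Real.sqrt_nonneg (r x)
      simp only [Pi.zero_apply]
      nlinarith [Real.sq_sqrt h1]
    rw [hr.integral_affine_add hr.integrable_sqrt, ← hmdef] at h1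
    have h2 : (m - A) * b = 1 - m ^ 2 := by
      apply mul_right_cancel₀ hq.ne'
      linarith
    have h3 : 0 ≤ A * b := by nlinarith
    exact nonneg_of_mul_nonneg_left h3 hb
  have hBA : B - A = b / (1 - p) := by
    rw [hA, hB]
    field_simp
    ring
  have hAB : A < B := by
    have : 0 < b / (1 - p) := by positivity
    linarith
  have hmean : p * B + (1 - p) * A = m := by
    rw [hA, hB]
    field_simp
    ring
  have hsec : p * B ^ 2 + (1 - p) * A ^ 2 = 1 := by
    have e : p * B ^ 2 + (1 - p) * A ^ 2 = m ^ 2 + p * b ^ 2 / (1 - p) := by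
      rw [hA, hB]
      field_simp
      ring
    rw [e, hbV]
    field_simp
    ring
  -- The integral of a quadratic in `√r` depends only on two moments, and the majorant is exact at
  -- `A` and `B`. Its integral is therefore the entropy of the two-point law.
  obtain ⟨k, hk, hkB⟩ := exists_quadratic_majorant hA0 hAB
  have h := integral_mono_ae (f := fun x => klFun (r x))
    (g := fun x => (2 * (k * A ^ 2 - A ^ 2)) + (2 * (Real.log A + k)) * r x +
      (2 * (A - 2 * k * A)) * √(r x)) hr.integrable_klFun
    (hr.integrable_affine_add hr.integrable_sqrt _ _ _) (by
      filter_upwards [hr.nonneg, hle] with x h1 h2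
      have h3 := hk _ (Real.sqrt_nonneg (r x)) h2
      rw [Real.log_sqrt h1, sub_sq, Real.sq_sqrt h1] at h3
      simp only [klFun]
      linarith)
  rw [hr.integral_affine_add hr.integrable_sqrt, ← hmdef] at h
  refine h.trans ?_
  have h2 := two_point_log_sobolev hp hp2 hA0 (by linarith : 0 < B) hsec
  rw [hmean] at h2
  refine le_trans (le_of_eq ?_) h2
  have e1 : 1 - 2 * m * A + A ^ 2 = p * (B - A) ^ 2 := by
    rw [← hmean]
    linear_combination -hsec
  linear_combination 2 * k * e1 + 2 * p * hkB + 2 * A * (-hmean) - 2 * Real.log A * hsec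

end

/-! ### The projection of a density onto the cone -/

section
variable {μ ν : Measure ℝ}

/-- The variational inequality for the projection, tested against nonincreasing functions. -/
theorem integral_sub_rayDensity_mul_le (h : MemLp (density μ ν) 2 ν) {w : ℝ → ℝ}
    (hw : MemLp w 2 ν) {S : Set ℝ} (hS : ∀ᵐ x ∂ν, x ∈ S) (hwS : AntitoneOn w S) :
    ∫ x, (density μ ν x - rayDensity h x) * (w x - rayDensity h x) ∂ν ≤ 0 := by
  have hwc : (hw.toLp w : Lp ℝ 2 ν) ∈ rayCone ν := by
    rw [mem_rayCone_iff]
    refine ⟨{x | x ∈ S ∧ (hw.toLp w : Lp ℝ 2 ν) x = w x}, ?_, ?_⟩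
    · filter_upwards [hS, hw.coeFn_toLp] with x h1 h2
      exact ⟨h1, h2⟩
    · rintro x ⟨h1, h2⟩ y ⟨k1, k2⟩ hxy
      rw [h2, k2]
      exact hwS h1 k1 hxy
  obtain ⟨hp, hmin⟩ := rayProj_spec ν h.toLp
  have hbdd : BddBelow (range fun w : rayCone ν => ‖h.toLp - (w : Lp ℝ 2 ν)‖) :=
    ⟨0, by rintro _ ⟨w, rfl⟩; exact norm_nonneg _⟩
  have hne : Nonempty (rayCone ν) := ⟨⟨0, zero_mem_rayCone ν⟩⟩
  have e : ‖h.toLp - rayProj ν h.toLp‖ = ⨅ w : rayCone ν, ‖h.toLp - (w : Lp ℝ 2 ν)‖ :=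
    le_antisymm (le_ciInf fun w => hmin w w.2) (ciInf_le hbdd ⟨rayProj ν h.toLp, hp⟩)
  have hin := (norm_eq_iInf_iff_real_inner_le_zero (convex_rayCone ν) hp).mp e _ hwc
  rw [L2.inner_def] at hin
  refine le_of_eq_of_le (integral_congr_ae ?_) hin
  filter_upwards [Lp.coeFn_sub h.toLp (rayProj ν h.toLp), Lp.coeFn_sub (hw.toLp w) (rayProj ν h.toLp),
    h.coeFn_toLp, hw.coeFn_toLp] with x h1 h2 h3 h4
  rw [h1, h2, Pi.sub_apply, Pi.sub_apply, h3, h4]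
  exact mul_comm _ _

theorem density_nonneg (x : ℝ) : 0 ≤ density μ ν x := ENNReal.toReal_nonneg

theorem exists_antitoneOn_rayDensity (h : MemLp (density μ ν) 2 ν) :
    ∃ S : Set ℝ, (∀ᵐ x ∂ν, x ∈ S) ∧ AntitoneOn (rayDensity h) S :=
  mem_rayCone_iff.mp (rayProj_spec ν h.toLp).1

theorem rayDensity_nonneg (h : MemLp (density μ ν) 2 ν) : 0 ≤ᵐ[ν] rayDensity h := by
  obtain ⟨S, hS, hanti⟩ := exists_antitoneOn_rayDensity h
  -- The positive part stays in the cone. The resulting integrand is nonnegative, so it vanishes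
  -- almost everywhere, yet it is positive wherever `ρ < 0`.
  have hm : MemLp (fun x => max (rayDensity h x) 0) 2 ν := (Lp.memLp (rayDensity h)).pos_part
  have hle := integral_sub_rayDensity_mul_le h hm hS
    (fun x hx y hy hxy => max_le_max (hanti hx hy hxy) le_rfl)
  have hnn : ∀ x, 0 ≤ (density μ ν x - rayDensity h x) *
      (max (rayDensity h x) 0 - rayDensity h x) := by
    intro x
    rcases le_total 0 (rayDensity h x) with h0 | h0
    · simp [max_eq_left h0]
    · rw [max_eq_right h0]
      exact mul_nonneg (by linarith [density_nonneg (μ := μ) (ν := ν) x]) (by linarith)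
  have hint : Integrable (fun x => (density μ ν x - rayDensity h x) *
      (max (rayDensity h x) 0 - rayDensity h x)) ν :=
    (h.sub (Lp.memLp (rayDensity h))).integrable_mul (hm.sub (Lp.memLp (rayDensity h)))
  have h0 := (integral_eq_zero_iff_of_nonneg hnn hint).mp (le_antisymm hle (integral_nonneg hnn))
  filter_upwards [h0] with x hx
  by_contra! hneg
  simp only [Pi.zero_apply] at hneg hx
  rw [max_eq_right hneg.le] at hx
  have h1 : 0 < density μ ν x - rayDensity h x := by
    linarith [density_nonneg (μ := μ) (ν := ν) x]
  exact (mul_pos h1 (by linarith : 0 < 0 - rayDensity h x)).ne' hx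

theorem integral_rayDensity [IsProbabilityMeasure μ] [IsProbabilityMeasure ν] (hμν : μ ≪ ν)
    (h : MemLp (density μ ν) 2 ν) : ∫ x, rayDensity h x ∂ν = 1 := by
  obtain ⟨S, hS, hanti⟩ := exists_antitoneOn_rayDensity h
  have hL := Lp.memLp (rayDensity h)
  -- Adding a constant of either sign stays in the cone, so the projection preserves the integral.
  have key : ∀ c : ℝ, (∫ x, (density μ ν x - rayDensity h x) ∂ν) * c ≤ 0 := by
    intro c
    have := integral_sub_rayDensity_mul_le h (w := fun x => rayDensity h x + c)
      (hL.add (memLp_const c)) hS (fun x hx y hy hxy => by have := hanti hx hy hxy; simpa using this)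
    simpa only [add_sub_cancel_left, integral_mul_const] using this
  have h1 := key 1
  have h2 := key (-1)
  have h3 : ∫ x, density μ ν x ∂ν = 1 := by
    unfold density
    rw [Measure.integral_toReal_rnDeriv hμν]
    simp
  rw [integral_sub (h.integrable (by norm_num)) (hL.integrable (by norm_num)), h3] at h1 h2
  linarith

end

/-! ### Finitely supported measures -/

section
variable {ν : Measure ℝ}

theorem FinitelySupported.ae_atom (hν : FinitelySupported ν) : ∀ᵐ x ∂ν, ν {x} ≠ 0 := by
  obtain ⟨S, hS⟩ := hν
  have hN : ν {x | x ∈ S ∧ ν {x} = 0} = 0 := by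
    have hc : {x | x ∈ S ∧ ν {x} = 0}.Countable :=
      (S.finite_toSet.subset fun x hx => hx.1).countable
    rw [← biUnion_of_singleton {x | x ∈ S ∧ ν {x} = 0}]
    exact (measure_biUnion_null_iff hc).mpr fun x hx => hx.2
  filter_upwards [measure_eq_zero_iff_ae_notMem.mp hS, measure_eq_zero_iff_ae_notMem.mp hN]
    with x h1 h2 h3
  exact h2 ⟨by simpa using h1, h3⟩

theorem FinitelySupported.finite_atoms (hν : FinitelySupported ν) : {x | ν {x} ≠ 0}.Finite := by
  obtain ⟨S, hS⟩ := hν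
  refine S.finite_toSet.subset fun x hx => ?_
  by_contra hxS
  exact hx (measure_mono_null (singleton_subset_iff.mpr hxS) hS)

theorem minAtom_le {x : ℝ} (hx : ν {x} ≠ 0) : minAtom ν ≤ ν.real {x} :=
  csInf_le ⟨0, by rintro _ ⟨y, _, rfl⟩; exact measureReal_nonneg⟩ ⟨x, hx, rfl⟩

theorem FinitelySupported.exists_minAtom [IsProbabilityMeasure ν] (hν : FinitelySupported ν) :
    ∃ x, ν {x} ≠ 0 ∧ ν.real {x} = minAtom ν := by
  obtain ⟨x, hx⟩ := hν.ae_atom.exists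
  have hne : ((fun x : ℝ => ν.real {x}) '' {x | ν {x} ≠ 0}).Nonempty := ⟨_, x, hx, rfl⟩
  exact hne.csInf_mem (hν.finite_atoms.image _)

theorem FinitelySupported.minAtom_pos [IsProbabilityMeasure ν] (hν : FinitelySupported ν) :
    0 < minAtom ν := by
  obtain ⟨x, hx, he⟩ := hν.exists_minAtom
  rw [← he]
  exact ENNReal.toReal_pos hx (measure_ne_top _ _)

theorem FinitelySupported.measureReal_singleton_le [IsProbabilityMeasure ν]
    (hν : FinitelySupported ν) (h1 : minAtom ν < 1) (x : ℝ) : ν.real {x} ≤ 1 - minAtom ν := by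
  obtain ⟨y, hyx, hy⟩ : ∃ y, y ≠ x ∧ ν {y} ≠ 0 := by
    by_contra! hall
    have hae : ∀ᵐ y ∂ν, y ∈ ({x} : Set ℝ) := by
      filter_upwards [hν.ae_atom] with y hy
      by_contra hyx
      exact hy (hall y hyx)
    have hx1 : ν {x} = 1 := (prob_compl_eq_zero_iff (measurableSet_singleton x)).mp hae
    obtain ⟨z, hz, he⟩ := hν.exists_minAtom
    have hzx : z = x := by
      by_contra hzx
      exact hz (hall z hzx)
    rw [← he, hzx, Measure.real, hx1] at h1
    simp at h1
  have h2 : ν.real ({x} ∪ {y}) = ν.real {x} + ν.real {y} :=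
    measureReal_union (by simpa using hyx.symm) (measurableSet_singleton y)
  have h3 : ν.real ({x} ∪ {y}) ≤ 1 := measureReal_le_one
  linarith [minAtom_le hy]

theorem FinitelySupported.minAtom_le_half [IsProbabilityMeasure ν]
    (hν : FinitelySupported ν) (h1 : minAtom ν < 1) : minAtom ν ≤ 1 / 2 := by
  obtain ⟨x, hx, he⟩ := hν.exists_minAtom
  linarith [hν.measureReal_singleton_le h1 x]

end

/-! ### Deviations at an atom and the bounds for finite supports -/

section
variable {ν : Measure ℝ}

theorem setIntegral_compl_singleton {u : ℝ → ℝ} (hu : Integrable u ν) (x : ℝ) :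
    ∫ y in {x}ᶜ, u y ∂ν = ∫ y, u y ∂ν - ν.real {x} * u x := by
  rw [← integral_add_compl (measurableSet_singleton x) hu, integral_singleton, smul_eq_mul]
  ring

/-- The value of a centred function at an atom is bounded by its `L¹` norm. -/
theorem measureReal_mul_abs_le {u : ℝ → ℝ} (hu : Integrable u ν) (h0 : ∫ y, u y ∂ν = 0) (x : ℝ) :
    ν.real {x} * |u x| ≤ (∫ y, |u y| ∂ν) / 2 := by
  have h1 := setIntegral_compl_singleton hu x
  have h2 := setIntegral_compl_singleton hu.abs x
  have h3 := abs_integral_le_integral_abs (f := u) (μ := ν.restrict {x}ᶜ)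
  rw [h1, h2, h0, zero_sub, abs_neg, abs_mul, abs_of_nonneg measureReal_nonneg] at h3
  linarith

/-- The value of a centred function at an atom is bounded by its variance. -/
theorem measureReal_mul_sq_le [IsProbabilityMeasure ν] {u : ℝ → ℝ} (hu : Integrable u ν)
    (hu2 : Integrable (fun y => u y ^ 2) ν) (h0 : ∫ y, u y ∂ν = 0) {x : ℝ} (hx : ν {x} ≠ 0) :
    ν.real {x} * u x ^ 2 ≤ (∫ y, u y ^ 2 ∂ν) * (1 - ν.real {x}) := by
  have hpos : 0 < ν.real {x} := ENNReal.toReal_pos hx (measure_ne_top _ _)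
  have h1 := setIntegral_compl_singleton hu x
  have h2 := setIntegral_compl_singleton hu2 x
  -- As `u` is centred, its integral off the atom is `-ν{x} u(x)`; Cauchy–Schwarz on the complement,
  -- of mass `1 - ν{x}`, gives the bound.
  have h3 := sq_integral_abs_le (ν := ν.restrict {x}ᶜ) hu.restrict hu2.restrict
    (integrable_const (1 : ℝ)) (ae_of_all _ fun y => sq_nonneg _) (ae_of_all _ fun y => zero_le_one)
    (ae_of_all _ fun y => by rw [mul_one])
  have h4 : ∫ y in {x}ᶜ, (1 : ℝ) ∂ν = 1 - ν.real {x} := by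
    rw [setIntegral_compl_singleton (integrable_const 1)]
    simp
  have h5 := abs_integral_le_integral_abs (f := u) (μ := ν.restrict {x}ᶜ)
  have h6 := pow_le_pow_left₀ (abs_nonneg _) h5 2
  rw [sq_abs, h1, h0] at h6
  rw [h2, h4] at h3
  have h7 := h6.trans h3
  refine le_of_mul_le_mul_left ?_ hpos
  nlinarith

theorem IsSqDensity.chiSq_le_of_finitelySupported [IsProbabilityMeasure ν] {r : ℝ → ℝ}
    (hr : IsSqDensity ν r) (hν : FinitelySupported ν) :
    ∫ x, chiSqFun (r x) ∂ν ≤ 2 / minAtom ν * (∫ x, tvFun (r x) ∂ν) ^ 2 := by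
  have hp := hν.minAtom_pos
  have hi : Integrable (fun x => r x - 1) ν := hr.integrable.sub (integrable_const 1)
  have h0 : ∫ x, (r x - 1) ∂ν = 0 := by
    rw [integral_sub hr.integrable (integrable_const 1), hr.integral_eq_one]
    simp
  have hT := integral_tvFun ν r
  set T := ∫ x, tvFun (r x) ∂ν
  have h := integral_mono_ae (f := fun x => chiSqFun (r x)) (g := fun x => T / minAtom ν * |r x - 1|)
    hr.integrable_chiSqFun (hi.abs.const_mul _) (by
      filter_upwards [hν.ae_atom] with x hx
      have h1 := measureReal_mul_abs_le hi h0 x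
      rw [← hT] at h1
      have h2 : |r x - 1| ≤ T / minAtom ν := by
        rw [le_div_iff₀ hp, mul_comm]
        exact (mul_le_mul_of_nonneg_right (minAtom_le hx) (abs_nonneg _)).trans h1
      simp only [chiSqFun]
      rw [← sq_abs, sq]
      exact mul_le_mul_of_nonneg_right h2 (abs_nonneg _))
  rw [integral_const_mul] at h
  refine h.trans (le_of_eq ?_)
  have : ∫ x, |r x - 1| ∂ν = 2 * T := by linarith
  rw [this]
  ring

theorem IsSqDensity.kl_le_of_finitelySupported [IsProbabilityMeasure ν] {r : ℝ → ℝ}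
    (hr : IsSqDensity ν r) (hν : FinitelySupported ν) (h1 : minAtom ν < 1) :
    ∫ x, klFun (r x) ∂ν ≤ klHlFactor (minAtom ν) * (1 - (∫ x, √(r x) ∂ν) ^ 2) := by
  have hp := hν.minAtom_pos
  have hp2 := hν.minAtom_le_half h1
  have hi : Integrable (fun x => √(r x) - ∫ y, √(r y) ∂ν) ν :=
    hr.integrable_sqrt.sub (integrable_const _)
  have h0 : ∫ x, (√(r x) - ∫ y, √(r y) ∂ν) ∂ν = 0 := by
    rw [integral_sub hr.integrable_sqrt (integrable_const _)]
    simp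
  set m := ∫ x, √(r x) ∂ν with hm
  have hae : ∀ᵐ x ∂ν, (√(r x) - m) ^ 2 = m ^ 2 + 1 * r x + (-2 * m) * √(r x) := by
    filter_upwards [hr.nonneg] with x hx
    linear_combination Real.sq_sqrt hx
  have hi2 : Integrable (fun x => (√(r x) - m) ^ 2) ν :=
    (hr.integrable_affine_add hr.integrable_sqrt (m ^ 2) 1 (-2 * m)).congr
      (hae.mono fun x hx => hx.symm)
  have hvar : ∫ x, (√(r x) - m) ^ 2 ∂ν = 1 - m ^ 2 := by
    rw [integral_congr_ae hae, hr.integral_affine_add hr.integrable_sqrt, ← hm]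
    ring
  have hV : 0 ≤ 1 - m ^ 2 := by
    rw [← hvar]
    exact integral_nonneg fun x => sq_nonneg _
  have hq : 0 ≤ 1 - minAtom ν := by linarith
  -- An atom of mass `q` allows a squared deviation of at most `(1 - m²)(1 - q) / q`, which is
  -- largest at the least mass.
  refine hr.kl_le_of_sqrt_le (b := √((1 - m ^ 2) * (1 - minAtom ν) / minAtom ν)) hp hp2
    (Real.sqrt_nonneg _) ?_ ?_
  · rw [Real.sq_sqrt (by positivity), mul_div_cancel₀ _ hp.ne']
  · filter_upwards [hν.ae_atom] with x hx
    have h2 := measureReal_mul_sq_le hi hi2 h0 hx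
    rw [hvar] at h2
    have h3 := minAtom_le hx
    have h4 : (√(r x) - m) ^ 2 ≤ (1 - m ^ 2) * (1 - minAtom ν) / minAtom ν := by
      rw [le_div_iff₀ hp]
      calc _ ≤ ν.real {x} * (√(r x) - m) ^ 2 := by
            rw [mul_comm]
            exact mul_le_mul_of_nonneg_right h3 (sq_nonneg _)
        _ ≤ _ := h2
        _ ≤ _ := mul_le_mul_of_nonneg_left (by linarith) hV
    linarith [Real.le_sqrt_of_sq_le h4]

theorem isSqDensity_rayDensity {μ : Measure ℝ} [IsProbabilityMeasure μ] [IsProbabilityMeasure ν]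
    (hμν : μ ≪ ν) (h : MemLp (density μ ν) 2 ν) : IsSqDensity ν (rayDensity h) :=
  ⟨Lp.memLp _, rayDensity_nonneg h, integral_rayDensity hμν h⟩

end

end RayDivergence

/-! ### The comparison inequalities for divergences over rays -/

theorem theorem4p8 (μ ν : Measure ℝ) [IsProbabilityMeasure μ] [IsProbabilityMeasure ν]
    (hμν : μ ≪ ν) (h : MemLp (density μ ν) 2 ν) :
    -- all the quantities below are well defined
    (0 ≤ᵐ[ν] rayDensity h ∧
      Integrable (fun x => tvFun (rayDensity h x)) ν ∧
      Integrable (fun x => hlFun (rayDensity h x)) ν ∧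
      Integrable (fun x => klFun (rayDensity h x)) ν ∧
      Integrable (fun x => chiSqFun (rayDensity h x)) ν ∧
      Integrable (fun x => lcFun (rayDensity h x)) ν ∧
      Integrable (fun x => jsFun (rayDensity h x)) ν ∧
      rayTV h < 1 ∧ rayHl h ^ 2 < 2) ∧
    -- total variation and Hellinger
    (1 / 2 * rayHl h ^ 2 ≤ rayTV h ∧
      rayTV h ≤ rayHl h * √(1 - rayHl h ^ 2 / 4) ∧
      rayHl h * √(1 - rayHl h ^ 2 / 4) ≤ 1 ∧
      rayTV h ≤ √(-2 * Real.log (1 - rayHl h ^ 2 / 2))) ∧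
    -- Kullback--Leibler and total variation: Pinsker, strong Pinsker, reverse Pinsker
    (rayTV h ^ 2 ≤ 1 / 2 * rayKL h ∧
      Real.log ((1 + rayTV h) / (1 - rayTV h)) - 2 * rayTV h / (1 + rayTV h) ≤ rayKL h ∧
      (FinitelySupported ν →
        rayKL h ≤ Real.log (1 + 2 / minAtom ν * rayTV h ^ 2) ∧
        Real.log (1 + 2 / minAtom ν * rayTV h ^ 2) ≤ 2 / minAtom ν * rayTV h ^ 2)) ∧
    -- total variation and chi-squared
    (rayTV h ^ 2 ≤ 1 / 4 * rayChiSq h ∧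
      rayTV h ≤ max (1 / 2) (rayChiSq h / (1 + rayChiSq h)) ∧
      4 * rayTV h ^ 2 ≤ tvChiFun (rayTV h) ∧
      tvChiFun (rayTV h) ≤ rayChiSq h) ∧
    -- Kullback--Leibler and Hellinger
    (rayHl h ^ 2 ≤ 2 * Real.log (2 / (2 - rayHl h ^ 2)) ∧
      2 * Real.log (2 / (2 - rayHl h ^ 2)) ≤ rayKL h ∧
      (FinitelySupported ν → minAtom ν < 1 →
        rayKL h ≤ klHlFactor (minAtom ν) * (1 - (1 - rayHl h ^ 2 / 2) ^ 2))) ∧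
    -- Kullback--Leibler and chi-squared
    (rayKL h ≤ Real.log (1 + rayChiSq h) ∧
      Real.log (1 + rayChiSq h) ≤ rayChiSq h) ∧
    -- Le Cam and Hellinger
    (1 / 2 * rayHl h ^ 2 ≤ rayLC h ∧ rayLC h ≤ rayHl h ^ 2) ∧
    -- Le Cam and Jensen--Shannon
    (rayLC h ≤ rayJS h ∧ rayJS h ≤ 2 * Real.log 2 * rayLC h) := by
  have hr := isSqDensity_rayDensity hμν h
  have hm := hr.integral_sqrt_pos
  have hH0 := integral_hlFun_nonneg ν (rayDensity h)
  have hH : rayHl h ^ 2 = 2 - 2 * ∫ x, √(rayDensity h x) ∂ν := by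
    rw [← hr.integral_hlFun]
    exact Real.sq_sqrt hH0
  have hHnn : 0 ≤ rayHl h := Real.sqrt_nonneg _
  rw [hr.integral_hlFun] at hH0
  have hT0 : 0 ≤ rayTV h := integral_tvFun_nonneg ν (rayDensity h)
  have hT1 : rayTV h < 1 := hr.tv_lt_one
  have hX0 : 0 ≤ rayChiSq h := integral_chiSqFun_nonneg ν (rayDensity h)
  have hTm : rayTV h ^ 2 ≤ 1 - (∫ x, √(rayDensity h x) ∂ν) ^ 2 := hr.tv_sq_le
  have hKX : rayKL h ≤ Real.log (1 + rayChiSq h) := hr.kl_le_log_one_add_chiSq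
  have hKm : -2 * Real.log (∫ x, √(rayDensity h x) ∂ν) ≤ rayKL h := hr.neg_two_log_le_kl
  have hHeq : rayHl h ^ 2 = rayDiv hlFun h := Real.sq_sqrt (integral_hlFun_nonneg ν (rayDensity h))
  set m := ∫ x, √(rayDensity h x) ∂ν with hmdef
  have hm1 : m ≤ 1 := by linarith
  have hlogm : Real.log m ≤ m - 1 := Real.log_le_sub_one_of_pos hm
  have hlog : Real.log (2 / (2 - rayHl h ^ 2)) = -Real.log m := by
    rw [← Real.log_inv, hH, show (2 : ℝ) - (2 - 2 * m) = 2 * m by ring]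
    congr 1
    field_simp
  have hlog1 : ∀ y : ℝ, 0 ≤ y → Real.log (1 + y) ≤ y := fun y hy => by
    linarith [Real.log_le_sub_one_of_pos (by linarith : 0 < 1 + y)]
  -- Since `H² = 2 (1 - m)`, the product `H² (1 - H²/4)` equals `(1 - m)(1 + m)`.
  have hprod : rayHl h * √(1 - rayHl h ^ 2 / 4) = √(1 - m ^ 2) := by
    nth_rewrite 1 [← Real.sqrt_sq hHnn]
    rw [← Real.sqrt_mul (sq_nonneg _), hH]
    congr 1
    ring
  have htvChi : tvChiFun (rayTV h) ≤ rayChiSq h ∧ 4 * rayTV h ^ 2 ≤ tvChiFun (rayTV h) := by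
    unfold tvChiFun
    split_ifs with hle
    · have : rayTV h ^ 2 ≤ 1 / 4 * rayChiSq h := hr.tv_sq_le_chiSq
      exact ⟨by linarith, le_rfl⟩
    · refine ⟨hr.tv_div_le_chiSq (not_le.mp hle).le, ?_⟩
      rw [le_div_iff₀ (by linarith)]
      -- `T - 4 T² (1 - T) = T (2T - 1)²`.
      nlinarith [mul_nonneg hT0 (sq_nonneg (2 * rayTV h - 1))]
  refine ⟨⟨hr.nonneg, hr.integrable_tvFun, hr.integrable_hlFun, hr.integrable_klFun,
    hr.integrable_chiSqFun, hr.integrable_lcFun, hr.integrable_jsFun, hT1, by linarith⟩,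
    ⟨?_, ?_, ?_, ?_⟩, ⟨hr.tv_sq_le_kl, hr.strong_pinsker, fun hν => ⟨?_, ?_⟩⟩,
    ⟨hr.tv_sq_le_chiSq, ?_, htvChi.2, htvChi.1⟩, ⟨?_, ?_, fun hν h1 => ?_⟩,
    ⟨hKX, hlog1 _ hX0⟩, ⟨?_, ?_⟩, ⟨?_, ?_⟩⟩
  · rw [hHeq]
    have := hr.affine_add_integral_le hr.integrable_hlFun hr.integrable_tvFun 0 0 (1 / 2)
      (fun t ht => by have := hlFun_le_abs ht; unfold tvFun; linarith)
    simpa [rayDiv, rayTV] using this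
  · rw [hprod]
    exact Real.le_sqrt_of_sq_le hTm
  · rw [hprod]
    exact Real.sqrt_le_one.mpr (by nlinarith)
  · refine Real.le_sqrt_of_sq_le (hTm.trans ?_)
    have e : 1 - rayHl h ^ 2 / 2 = m := by linarith
    have := Real.log_le_sub_one_of_pos (by positivity : 0 < m ^ 2)
    rw [Real.log_pow] at this
    rw [e]
    push_cast at this
    linarith
  · have hc : rayChiSq h ≤ 2 / minAtom ν * rayTV h ^ 2 := hr.chiSq_le_of_finitelySupported hν
    exact hKX.trans (Real.log_le_log (by linarith) (by linarith))
  · have := hν.minAtom_pos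
    exact hlog1 _ (by positivity)
  · rcases le_or_gt (rayTV h) (1 / 2) with hle | hgt
    · exact le_max_of_le_left hle
    · refine le_max_of_le_right ?_
      have : rayTV h / (1 - rayTV h) ≤ rayChiSq h := hr.tv_div_le_chiSq hgt.le
      rw [div_le_iff₀ (by linarith)] at this
      rw [le_div_iff₀ (by linarith)]
      linarith
  · rw [hlog, hH]
    linarith
  · rw [hlog]
    linarith
  · have e : 1 - rayHl h ^ 2 / 2 = m := by linarith
    rw [e]
    exact hr.kl_le_of_finitelySupported hν h1
  · rw [hHeq]
    have := hr.affine_add_integral_le hr.integrable_hlFun hr.integrable_lcFun 0 0 (1 / 2)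
      (fun t ht => by linarith [hlFun_le_lcFun ht])
    simpa [rayDiv, rayLC] using this
  · rw [hHeq]
    exact hr.integral_comp_le hr.integrable_lcFun hr.integrable_hlFun fun t ht => lcFun_le_hlFun ht
  · exact hr.integral_comp_le hr.integrable_lcFun hr.integrable_jsFun
      fun t ht => (lcFun_le_jsFun_le ht).1
  · refine (hr.integral_comp_le (g := fun t => 2 * Real.log 2 * lcFun t) hr.integrable_jsFun
      (hr.integrable_lcFun.const_mul _) fun t ht => (lcFun_le_jsFun_le ht).2).trans (le_of_eq ?_)
    exact integral_const_mul _ _
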